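/- **Theorem (2-dimensional reverse isoperimetric inequality).** Let $\lambda>0$. A convex body in $\mathbb{R}^2$ (a compact convex set with non-empty interior) $K$ is called *$\lambda$-convex* if for every $p\in\partial K$ there are a neighbourhood $U_p$ of $p$ and a closed disk $\mathcal{B}$ of radius $1/\lambda$ with $p\in\partial\mathcal{B}$ such that $U_p\cap\partial K\subset\mathcal{B}$. A *$\lambda$-convex lens* is the intersection of two distinct closed disks of radius $1/\lambda$, provided that this intersection has non-empty interior. Write $|\cdot|$ for area and $|\partial\,\cdot\,|$ for the length of the boundary. Let $K\subset\mathbb{R}^2$ be a $\lambda$-convex body and let $L\subset\mathbb{R}^2$ be a $\lambda$-convex lens with $|\partial K|=|\partial L|$. Then $|K|\ge|L|$, and equality $|K|=|L|$ is possible only if $K$ is a $\lambda$-convex lens. -/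

import Mathlib

open MeasureTheory Topology

/-- A `lam`-convex body in the Euclidean plane: a compact convex set with non-empty interior such
that through every boundary point `p` passes a circle of radius `1 / lam` whose closed disk contains
the part of the boundary of `K` in some neighbourhood of `p`. -/
structure IsLambdaConvexBody (lam : ℝ) (K : Set (EuclideanSpace ℝ (Fin 2))) : Prop where
  isCompact : IsCompact K
  convex : Convex ℝ K
  interior_nonempty : (interior K).Nonempty
  locally_supported : ∀ p ∈ frontier K, ∃ U ∈ 𝓝 p, ∃ c : EuclideanSpace ℝ (Fin 2),
    p ∈ Metric.sphere c (1 / lam) ∧ U ∩ frontier K ⊆ Metric.closedBall c (1 / lam)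

/-- A `lam`-convex lens in the Euclidean plane: the intersection of two distinct closed disks of
radius `1 / lam`, having non-empty interior. -/
def IsLambdaConvexLens (lam : ℝ) (L : Set (EuclideanSpace ℝ (Fin 2))) : Prop :=
  ∃ c₁ c₂ : EuclideanSpace ℝ (Fin 2), c₁ ≠ c₂ ∧
    L = Metric.closedBall c₁ (1 / lam) ∩ Metric.closedBall c₂ (1 / lam) ∧ (interior L).Nonempty

/-- The perimeter `|∂K|`: the one-dimensional Hausdorff measure of the boundary. -/
noncomputable def perimeter (K : Set (EuclideanSpace ℝ (Fin 2))) : ENNReal :=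
  Measure.hausdorffMeasure 1 (frontier K)

/-!
Let `R = 1 / λ`. The local condition propagates: comparing support functions with sinusoids, `K`
lies in the disk of radius `R` tangent from inside at each boundary point. Hence `K` is strictly
convex, its boundary point `X θ` with outer normal angle `θ` is a Lipschitz function of `θ`, and its
radius of curvature `ρ` takes values in `[0, R]`. The perimeter is `∫ ρ`, and twice the area is
`∫ ⟪X - p, u⟫ ρ`.

Cut the curve at two opposite normal angles. The chord terms of the two halves cancel, so twice the
area is the sum of two double integrals `∬ sin (θ - t) ρ t ρ θ` over `t ≤ θ`. In the variable
`s = ∫ ρ / R`, concavity of the sine on `[0, π]` together with `ρ ≤ R` bounds each of them below by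
`R² (x - sin x)`, where `R x` is the length of the half. Convexity of `x - sin x` gives
`area ≥ R² (m - sin m)` for perimeter `2 R m`, which is the area of a lens.

In the equality case the halves have equal length for every cut, and almost every pair of boundary
points sees no gap or the full gap `π - m` in the growth of `∫ ρ / R`. So the whole gap is
concentrated in a single vertex per half turn, and `K` is a lens.
-/

open Set Filter Real
open scoped RealInnerProductSpace

/-! ### Rotating frames in the plane -/

/-- The Euclidean plane. -/
abbrev Plane := EuclideanSpace ℝ (Fin 2)

/-- The unit vector of argument `θ`. Together with `tangentVec θ` it is the moving frame at a
boundary point with outer normal angle `θ`. -/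
noncomputable def unitVec (θ : ℝ) : Plane := !₂[cos θ, sin θ]

/-- The unit vector of argument `θ` turned by a right angle, the derivative of `unitVec`. -/
noncomputable def tangentVec (θ : ℝ) : Plane := !₂[-sin θ, cos θ]

theorem inner_plane (x y : Plane) : ⟪x, y⟫ = x 0 * y 0 + x 1 * y 1 := by
  simp [PiLp.inner_apply, Fin.sum_univ_two, mul_comm]

theorem plane_ext {x y : Plane} (h0 : x 0 = y 0) (h1 : x 1 = y 1) : x = y := by
  ext i; fin_cases i <;> assumption

@[simp] theorem unitVec_zero (θ : ℝ) : unitVec θ 0 = cos θ := by simp [unitVec]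
@[simp] theorem unitVec_one (θ : ℝ) : unitVec θ 1 = sin θ := by simp [unitVec]
@[simp] theorem tangentVec_zero (θ : ℝ) : tangentVec θ 0 = -sin θ := by simp [tangentVec]
@[simp] theorem tangentVec_one (θ : ℝ) : tangentVec θ 1 = cos θ := by simp [tangentVec]

theorem inner_unitVec_unitVec (a b : ℝ) : ⟪unitVec a, unitVec b⟫ = cos (a - b) := by
  rw [inner_plane, cos_sub]; simp

theorem inner_unitVec_tangentVec (a b : ℝ) : ⟪unitVec a, tangentVec b⟫ = sin (a - b) := by
  rw [inner_plane, sin_sub]; simp; ring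

theorem inner_tangentVec_unitVec (a b : ℝ) : ⟪tangentVec a, unitVec b⟫ = sin (b - a) := by
  rw [real_inner_comm, inner_unitVec_tangentVec]

theorem inner_tangentVec_tangentVec (a b : ℝ) :
    ⟪tangentVec a, tangentVec b⟫ = cos (a - b) := by
  rw [inner_plane, cos_sub]; simp; ring

theorem norm_unitVec (θ : ℝ) : ‖unitVec θ‖ = 1 := by
  rw [norm_eq_sqrt_real_inner, inner_unitVec_unitVec, sub_self, cos_zero, sqrt_one]

theorem norm_tangentVec (θ : ℝ) : ‖tangentVec θ‖ = 1 := by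
  rw [norm_eq_sqrt_real_inner, inner_tangentVec_tangentVec, sub_self, cos_zero, sqrt_one]

theorem inner_eq_frame (w z : Plane) (θ : ℝ) :
    ⟪w, z⟫ = ⟪w, unitVec θ⟫ * ⟪z, unitVec θ⟫ + ⟪w, tangentVec θ⟫ * ⟪z, tangentVec θ⟫ := by
  simp only [inner_plane, unitVec_zero, unitVec_one, tangentVec_zero, tangentVec_one]
  linear_combination (-(w 0 * z 0 + w 1 * z 1)) * sin_sq_add_cos_sq θ

theorem norm_sq_eq_frame (w : Plane) (θ : ℝ) :
    ‖w‖ ^ 2 = ⟪w, unitVec θ⟫ ^ 2 + ⟪w, tangentVec θ⟫ ^ 2 := by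
  rw [← real_inner_self_eq_norm_sq, inner_eq_frame w w θ, sq, sq]

theorem inner_unitVec_eq_frame (w : Plane) (θ φ : ℝ) :
    ⟪w, unitVec φ⟫ = ⟪w, unitVec θ⟫ * cos (φ - θ) + ⟪w, tangentVec θ⟫ * sin (φ - θ) := by
  rw [inner_eq_frame w (unitVec φ) θ, inner_unitVec_unitVec, inner_unitVec_tangentVec]

theorem sin_mul_inner_unitVec (w : Plane) (a b t : ℝ) : sin (b - a) * ⟪w, unitVec t⟫ =
    sin (b - t) * ⟪w, unitVec a⟫ + sin (t - a) * ⟪w, unitVec b⟫ := by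
  simp only [inner_plane, unitVec_zero, unitVec_one, sin_sub]
  ring

theorem eq_of_inner_frame {w z : Plane} (θ : ℝ) (hu : ⟪w, unitVec θ⟫ = ⟪z, unitVec θ⟫)
    (ht : ⟪w, tangentVec θ⟫ = ⟪z, tangentVec θ⟫) : w = z := by
  have h : ‖w - z‖ ^ 2 = 0 := by
    rw [norm_sq_eq_frame (w - z) θ, inner_sub_left, inner_sub_left, hu, ht]
    ring
  rwa [sq_eq_zero_iff, norm_sub_eq_zero_iff] at h

theorem hasDerivAt_plane {f : ℝ → Plane} {f' : Plane} {t : ℝ}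
    (h0 : HasDerivAt (fun s => f s 0) (f' 0) t) (h1 : HasDerivAt (fun s => f s 1) (f' 1) t) :
    HasDerivAt f f' t := by
  have h : HasDerivAt (fun s i => f s i) (fun i => f' i) t :=
    hasDerivAt_pi.2 fun i => by fin_cases i <;> assumption
  exact (PiLp.hasFDerivAt_toLp (𝕜 := ℝ) 2 (fun i => f t i)).comp_hasDerivAt t h

theorem hasDerivAt_unitVec (θ : ℝ) : HasDerivAt unitVec (tangentVec θ) θ := by
  apply hasDerivAt_plane
  · simpa using hasDerivAt_cos θ
  · simpa using hasDerivAt_sin θ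

theorem hasDerivAt_tangentVec (θ : ℝ) : HasDerivAt tangentVec (-unitVec θ) θ := by
  apply hasDerivAt_plane
  · simpa using (hasDerivAt_sin θ).fun_neg
  · simpa using hasDerivAt_cos θ

@[fun_prop]
theorem continuous_unitVec : Continuous unitVec :=
  continuous_iff_continuousAt.2 fun θ => (hasDerivAt_unitVec θ).continuousAt

@[fun_prop]
theorem continuous_tangentVec : Continuous tangentVec :=
  continuous_iff_continuousAt.2 fun θ => (hasDerivAt_tangentVec θ).continuousAt

theorem hasDerivAt_inner_unitVec (w : Plane) (θ : ℝ) :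
    HasDerivAt (fun φ => ⟪w, unitVec φ⟫) ⟪w, tangentVec θ⟫ θ := by
  simpa using (hasDerivAt_const θ w).inner ℝ (hasDerivAt_unitVec θ)

theorem unitVec_add (a b : ℝ) : unitVec (a + b) = cos b • unitVec a + sin b • tangentVec a :=
  plane_ext (by simp [cos_add]; ring) (by simp [sin_add]; ring)

theorem unitVec_add_pi (θ : ℝ) : unitVec (θ + π) = -unitVec θ := by
  apply plane_ext <;> simp [cos_add_pi, sin_add_pi]

theorem unitVec_add_two_pi (θ : ℝ) : unitVec (θ + 2 * π) = unitVec θ := by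
  simp [unitVec]

theorem norm_unitVec_sub_le (a b : ℝ) : ‖unitVec a - unitVec b‖ ≤ |a - b| := by
  have hderiv (x : ℝ) : ‖deriv unitVec x‖ ≤ 1 := by
    rw [(hasDerivAt_unitVec x).deriv, norm_tangentVec]
  simpa using Convex.norm_image_sub_le_of_norm_deriv_le (s := univ)
    (fun x _ => (hasDerivAt_unitVec x).differentiableAt) (fun x _ => hderiv x) convex_univ
    (mem_univ b) (mem_univ a)

theorem exists_eq_norm_smul_unitVec (w : Plane) (a : ℝ) :
    ∃ θ ∈ Ico a (a + 2 * π), w = ‖w‖ • unitVec θ := by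
  set z : ℂ := ⟨w 0, w 1⟩
  have hz : ‖z‖ = ‖w‖ := by
    rw [Complex.norm_eq_sqrt_sq_add_sq, norm_eq_sqrt_real_inner, inner_plane, sq, sq]
  set k := toIcoDiv two_pi_pos a z.arg
  have hk : toIcoMod two_pi_pos a z.arg = z.arg - k * (2 * π) := by
    rw [toIcoMod, zsmul_eq_mul]
  refine ⟨toIcoMod two_pi_pos a z.arg, toIcoMod_mem_Ico _ _ _, ?_⟩
  rw [hk, ← hz]
  apply plane_ext
  · simp [cos_sub_int_mul_two_pi, Complex.norm_mul_cos_arg, z]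
  · simp [sin_sub_int_mul_two_pi, Complex.norm_mul_sin_arg, z]

/-! ### Sinusoidal comparison -/

theorem exists_mem_Ioo_lt_of_hasDerivWithinAt_neg {f : ℝ → ℝ} {f' a b : ℝ}
    (hf : HasDerivWithinAt f f' (Ioi a) a) (hf' : f' < 0) (hab : a < b) :
    ∃ t ∈ Ioo a b, f t < f a := by
  have hslope : ∀ᶠ t in 𝓝[>] a, slope f a t < 0 :=
    ((hasDerivWithinAt_iff_tendsto_slope' self_notMem_Ioi).1 hf).eventually (gt_mem_nhds hf')
  obtain ⟨t, hst, ht⟩ := (hslope.and (Ioo_mem_nhdsGT hab)).exists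
  rw [slope_def_field, div_neg_iff] at hst
  exact ⟨t, ht, sub_neg.1 (hst.resolve_left fun h => (sub_pos.2 ht.1).not_gt h.2).1⟩

/-- That `f` is nowhere touched from below by a sinusoid is a weak form of `f'' + f < 0`. A positive
value `f T` would make the quotient of `f - κ sin`, for the `κ` making it vanish at `T`, by
`cos (· - T / 2)` have a negative interior minimum, and there a sinusoid touches `f`. -/
theorem nonpos_of_not_touched_by_sinusoid {f : ℝ → ℝ} {T : ℝ} (hT : T ∈ Ioo 0 π)
    (hf : ContinuousOn f (Icc 0 T)) (hf0 : f 0 = 0) (hf' : HasDerivWithinAt f 0 (Ioi 0) 0)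
    (hno : ∀ t ∈ Ioo 0 T, ∀ A B : ℝ, f t = A * cos t + B * sin t →
      ¬∀ᶠ s in 𝓝 t, A * cos s + B * sin s ≤ f s) : f T ≤ 0 := by
  by_contra! hfT
  have hsinT : 0 < sin T := sin_pos_of_mem_Ioo hT
  set κ := f T / sin T
  have hκ : 0 < κ := by positivity
  set g : ℝ → ℝ := fun t => f t - κ * sin t
  have hg0 : g 0 = 0 := by simp [g, hf0]
  have hgT : g T = 0 := by simp [g, κ, hsinT.ne']
  have hg' : HasDerivWithinAt g (-κ) (Ioi 0) 0 := by
    simpa using hf'.fun_sub ((hasDerivAt_sin 0).const_mul κ).hasDerivWithinAt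
  obtain ⟨t₁, ht₁, hgt₁⟩ := exists_mem_Ioo_lt_of_hasDerivWithinAt_neg hg' (neg_lt_zero.2 hκ) hT.1
  rw [hg0] at hgt₁
  have hcos : ∀ t ∈ Icc 0 T, 0 < cos (t - T / 2) := fun t ht =>
    cos_pos_of_mem_Ioo ⟨by linarith [ht.1, hT.2], by linarith [ht.2, hT.2]⟩
  obtain ⟨t₂, ht₂, hmin⟩ := isCompact_Icc.exists_isMinOn (nonempty_Icc.2 hT.1.le)
    (f := fun t => g t / cos (t - T / 2))
    (ContinuousOn.div (by fun_prop) (by fun_prop) fun t ht => (hcos t ht).ne')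
  set q := g t₂ / cos (t₂ - T / 2) with hq
  have hq0 : q < 0 := (hmin (Ioo_subset_Icc_self ht₁)).trans_lt
    (div_neg_of_neg_of_pos hgt₁ (hcos _ (Ioo_subset_Icc_self ht₁)))
  have ht₂' : t₂ ∈ Ioo 0 T := by
    refine ⟨lt_of_le_of_ne ht₂.1 ?_, lt_of_le_of_ne ht₂.2 ?_⟩ <;> rintro rfl
    · simp [hq, hg0] at hq0
    · simp [hq, hgT] at hq0
  have hsinusoid (t : ℝ) : q * cos (T / 2) * cos t + (κ + q * sin (T / 2)) * sin t =
      f t - (g t - q * cos (t - T / 2)) := by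
    simp only [g, cos_sub]; ring
  refine hno t₂ ht₂' (q * cos (T / 2)) (κ + q * sin (T / 2)) ?_ ?_
  · rw [hsinusoid, hq, div_mul_cancel₀ _ (hcos t₂ ht₂).ne', sub_self, sub_zero]
  · filter_upwards [Icc_mem_nhds ht₂'.1 ht₂'.2] with t ht
    have hqt : q * cos (t - T / 2) ≤ g t := (le_div_iff₀ (hcos t ht)).1 (hmin ht)
    rw [hsinusoid]
    linarith

theorem nonpos_of_not_touched_by_sinusoid_of_abs_lt_pi {f : ℝ → ℝ} (hf : Continuous f)
    (hf0 : f 0 = 0) (hf' : HasDerivAt f 0 0)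
    (hno : ∀ t A B : ℝ, f t = A * cos t + B * sin t →
      ¬∀ᶠ s in 𝓝 t, A * cos s + B * sin s ≤ f s) {T : ℝ} (hT : |T| < π) : f T ≤ 0 := by
  rcases lt_trichotomy T 0 with hneg | rfl | hpos
  · have hrefl : HasDerivAt (fun t => f (-t)) 0 0 := by
      simpa only [Function.comp_def, mul_neg_one, neg_zero] using
        hf'.comp_of_eq 0 (hasDerivAt_neg 0) neg_zero.symm
    rw [← neg_neg T]
    refine nonpos_of_not_touched_by_sinusoid (f := fun t => f (-t))
      ⟨neg_pos.2 hneg, (neg_le_abs T).trans_lt hT⟩ (by fun_prop) (by simpa using hf0)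
      hrefl.hasDerivWithinAt fun t _ A B heq htouch => ?_
    refine hno (-t) A (-B) (by simpa using heq) ?_
    have hlim : Tendsto Neg.neg (𝓝 (-t)) (𝓝 t) := by simpa using tendsto_neg (-t)
    filter_upwards [hlim.eventually htouch] with s hs
    simpa using hs
  · exact hf0.le
  · exact nonpos_of_not_touched_by_sinusoid ⟨hpos, (le_abs_self T).trans_lt hT⟩ hf.continuousOn
      hf0 hf'.hasDerivWithinAt fun t _ => hno t

/-! ### Boundary curves parametrized by the outer normal angle -/

/-- `X θ` is a point of `K` at which `⟪·, unitVec θ⟫` is maximal: the curve `X` runs along the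
boundary of `K`, the parameter being the outer normal angle. The support function of `K` is
`⟪X θ, unitVec θ⟫`. -/
structure IsSupportCurve (K : Set Plane) (X : ℝ → Plane) : Prop where
  mem : ∀ θ, X θ ∈ K
  inner_le : ∀ θ, ∀ y ∈ K, ⟪y, unitVec θ⟫ ≤ ⟪X θ, unitVec θ⟫

/-- Near the parameter `θ` the curve stays in a closed disk of radius `R` bounded by a circle
through `X θ`. -/
def LocallyInDisk (R : ℝ) (X : ℝ → Plane) (θ : ℝ) : Prop :=
  ∃ c, ‖X θ - c‖ = R ∧ ∀ᶠ φ in 𝓝 θ, ‖X φ - c‖ ≤ R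

/-- The radius of curvature of a curve parametrized by its normal angle. It takes the junk value `0`
where the curve is not differentiable. -/
noncomputable def curvRadius (X : ℝ → Plane) (θ : ℝ) : ℝ := ⟪deriv X θ, tangentVec θ⟫

theorem measurable_curvRadius (X : ℝ → Plane) : Measurable (curvRadius X) :=
  (measurable_deriv X).inner continuous_tangentVec.measurable

theorem mem_frontier_of_forall_inner_le {K : Set Plane} {θ : ℝ} {x : Plane} (hx : x ∈ K)
    (h : ∀ y ∈ K, ⟪y, unitVec θ⟫ ≤ ⟪x, unitVec θ⟫) : x ∈ frontier K := by
  refine ⟨subset_closure hx, fun hint => ?_⟩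
  have hlim : Tendsto (fun ε : ℝ => x + ε • unitVec θ) (𝓝[>] 0) (𝓝 x) := by
    refine Tendsto.mono_left ?_ nhdsWithin_le_nhds
    exact Continuous.tendsto' (by fun_prop) _ _ (by simp)
  obtain ⟨ε, hmem, hε : 0 < ε⟩ := ((hlim.eventually (mem_interior_iff_mem_nhds.1 hint)).and
    self_mem_nhdsWithin).exists
  have hle := h _ hmem
  rw [inner_add_left, real_inner_smul_left, inner_unitVec_unitVec, sub_self, cos_zero] at hle
  linarith

theorem exists_isSupportCurve_of_isCompact {K : Set Plane} (hK : IsCompact K) (hne : K.Nonempty) :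
    ∃ X, IsSupportCurve K X := by
  have hex (θ : ℝ) : ∃ x ∈ K, ∀ y ∈ K, ⟪y, unitVec θ⟫ ≤ ⟪x, unitVec θ⟫ :=
    hK.exists_isMaxOn hne (f := fun y => ⟪y, unitVec θ⟫) (by fun_prop)
  choose X hmem hle using hex
  exact ⟨X, hmem, hle⟩

namespace IsSupportCurve

variable {K : Set Plane} {X : ℝ → Plane}

theorem inner_sub_nonneg (hX : IsSupportCurve K X) {p : Plane} (hp : p ∈ K) (θ : ℝ) :
    0 ≤ ⟪X θ - p, unitVec θ⟫ := by
  rw [inner_sub_left]; linarith [hX.inner_le θ p hp]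

theorem mem_frontier (hX : IsSupportCurve K X) (θ : ℝ) : X θ ∈ frontier K :=
  mem_frontier_of_forall_inner_le (hX.mem θ) (hX.inner_le θ)

theorem continuous_of_unique (hX : IsSupportCurve K X) (hK : IsCompact K)
    (huniq : ∀ θ, ∀ y ∈ K, ⟪y, unitVec θ⟫ = ⟪X θ, unitVec θ⟫ → y = X θ) : Continuous X := by
  refine continuous_iff_continuousAt.2 fun θ =>
    hK.tendsto_nhds_of_unique_mapClusterPt (Eventually.of_forall hX.mem) fun y hy hcl => ?_
  obtain ⟨U, hU, hUy⟩ := mapClusterPt_iff_ultrafilter.1 hcl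
  have hu : Tendsto unitVec U (𝓝 (unitVec θ)) := (continuous_unitVec.tendsto θ).mono_left hU
  refine huniq θ y hy (le_antisymm (hX.inner_le θ y hy) ?_)
  exact le_of_tendsto_of_tendsto' (tendsto_const_nhds.inner hu) (hUy.inner hu)
    fun φ => hX.inner_le φ _ (hX.mem θ)

theorem hasDerivAt_inner (hX : IsSupportCurve K X) (hc : Continuous X) (θ : ℝ) :
    HasDerivAt (fun φ => ⟪X φ, unitVec φ⟫) ⟪X θ, tangentVec θ⟫ θ := by
  have hbound (φ : ℝ) : ‖⟪X φ - X θ, unitVec φ⟫‖ ≤ 1 * ‖‖X φ - X θ‖ * (φ - θ)‖ := by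
    rw [norm_of_nonneg (hX.inner_sub_nonneg (hX.mem θ) φ), one_mul, norm_mul, norm_norm]
    calc ⟪X φ - X θ, unitVec φ⟫ ≤ ⟪X φ - X θ, unitVec φ - unitVec θ⟫ := by
          rw [inner_sub_right, inner_sub_left _ _ (unitVec θ)]
          linarith [hX.inner_le θ _ (hX.mem φ)]
      _ ≤ ‖X φ - X θ‖ * ‖unitVec φ - unitVec θ‖ := real_inner_le_norm _ _
      _ ≤ ‖X φ - X θ‖ * ‖φ - θ‖ := by
          gcongr
          exact norm_unitVec_sub_le φ θ
  have hsmall : (fun φ => ‖X φ - X θ‖) =o[𝓝 θ] fun _ => (1 : ℝ) :=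
    (Asymptotics.isLittleO_one_iff ℝ).2 (Continuous.tendsto' (by fun_prop) _ _ (by simp))
  have hdiff : HasDerivAt (fun φ => ⟪X φ - X θ, unitVec φ⟫) 0 θ := by
    rw [hasDerivAt_iff_isLittleO]
    simp only [sub_self, inner_zero_left, sub_zero, smul_zero]
    have := (Asymptotics.IsBigO.of_bound 1 (Eventually.of_forall hbound)).trans_isLittleO
      (hsmall.mul_isBigO (Asymptotics.isBigO_refl (fun φ => φ - θ) (𝓝 θ)))
    simpa only [one_mul] using this
  simpa [inner_sub_left] using hdiff.fun_add (hasDerivAt_inner_unitVec (X θ) θ)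

theorem inner_deriv_unitVec (hX : IsSupportCurve K X) (θ : ℝ) : ⟪deriv X θ, unitVec θ⟫ = 0 := by
  by_cases hd : DifferentiableAt ℝ X θ
  · have hmax : IsLocalMax (fun φ => ⟪X φ, unitVec θ⟫) θ :=
      Eventually.of_forall fun φ => hX.inner_le θ _ (hX.mem φ)
    refine hmax.hasDerivAt_eq_zero ?_
    simpa using hd.hasDerivAt.inner ℝ (hasDerivAt_const θ (unitVec θ))
  · rw [deriv_zero_of_not_differentiableAt hd, inner_zero_left]

theorem deriv_eq (hX : IsSupportCurve K X) (θ : ℝ) :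
    deriv X θ = curvRadius X θ • tangentVec θ := by
  apply eq_of_inner_frame θ
  · rw [hX.inner_deriv_unitVec, real_inner_smul_left, inner_tangentVec_unitVec, sub_self, sin_zero,
      mul_zero]
  · rw [real_inner_smul_left, inner_tangentVec_tangentVec, sub_self, cos_zero, mul_one, curvRadius]

theorem curvRadius_nonneg (hX : IsSupportCurve K X) (θ : ℝ) : 0 ≤ curvRadius X θ := by
  by_cases hd : DifferentiableAt ℝ X θ
  · have hslope := (hasDerivAt_iff_tendsto_slope.1 hd.hasDerivAt).inner (𝕜 := ℝ)
      (hasDerivAt_iff_tendsto_slope.1 (hasDerivAt_unitVec θ))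
    refine ge_of_tendsto hslope (Eventually.of_forall fun φ => ?_)
    have hmono : 0 ≤ ⟪X φ - X θ, unitVec φ - unitVec θ⟫ := by
      rw [inner_sub_right, inner_sub_left, inner_sub_left]
      linarith [hX.inner_le θ _ (hX.mem φ), hX.inner_le φ _ (hX.mem θ)]
    simp only [slope_def_module]
    rw [real_inner_smul_left, real_inner_smul_right, ← mul_assoc]
    exact mul_nonneg (mul_self_nonneg _) hmono
  · rw [curvRadius, deriv_zero_of_not_differentiableAt hd, inner_zero_left]

end IsSupportCurve

/-! ### From local to global inclusion in disks -/

/-- Here `w` and `w + d` stand for the positions of `X θ` and `X (θ + s)` relative to the center of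
the disk of radius `R`. For `s → 0` the estimate forces `⟪w, tangentVec θ⟫ = 0`. -/
theorem tangential_mul_sin_mul_cos_le {w d : Plane} {R R' θ s : ℝ} (hR' : 0 < R') (hw : ‖w‖ = R)
    (hd : ‖w + d‖ ≤ R) (hle : ⟪d, unitVec θ⟫ ≤ 0)
    (hout : R' * (1 - cos s) ≤ ⟪d, unitVec (θ + s)⟫) (hcos : 0 < cos s) :
    ⟪w, tangentVec θ⟫ * (sin s * cos s) ≤ R * sin s ^ 2 := by
  set a := ⟪d, tangentVec θ⟫ with ha
  set b := ⟪d, unitVec θ⟫ with hb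
  set β := ⟪w, tangentVec θ⟫ with hβ
  rw [inner_unitVec_eq_frame d θ, add_sub_cancel_left, ← ha, ← hb] at hout
  have hαR : ⟪w, unitVec θ⟫ ≤ R := by
    simpa [norm_unitVec, hw] using real_inner_le_norm w (unitVec θ)
  have hR : 0 ≤ R := hw ▸ norm_nonneg w
  have haβ : a * β ≤ -b * R := by
    have h : ‖w + d‖ ^ 2 ≤ R ^ 2 := by gcongr
    rw [norm_add_sq_real, hw, norm_sq_eq_frame d θ, inner_eq_frame w d θ] at h
    nlinarith [mul_nonneg (neg_nonneg.2 hle) (sub_nonneg.2 hαR)]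
  rcases eq_or_ne (sin s) 0 with h0 | h0
  · simp [h0]
  have hcos1 : 0 < 1 - cos s := by
    nlinarith [sin_sq_add_cos_sq s, sq_pos_of_ne_zero h0, cos_le_one s]
  have hb_cos : -b * cos s ≤ a * sin s := by nlinarith
  have hpos : 0 < a * sin s := by nlinarith [mul_pos hR' hcos1]
  refine le_of_mul_le_mul_left ?_ hpos
  calc a * sin s * (β * (sin s * cos s)) = a * β * cos s * sin s ^ 2 := by ring
    _ ≤ -b * R * cos s * sin s ^ 2 := by gcongr
    _ = R * (-b * cos s) * sin s ^ 2 := by ring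
    _ ≤ R * (a * sin s) * sin s ^ 2 := by gcongr
    _ = a * sin s * (R * sin s ^ 2) := by ring

theorem eq_zero_of_eventually_mul_sin_mul_cos_le {β R : ℝ}
    (h : ∀ᶠ s in 𝓝 0, β * (sin s * cos s) ≤ R * sin s ^ 2) : β = 0 := by
  have hmax : IsLocalMax (fun s => β * (sin s * cos s) - R * sin s ^ 2) 0 := by
    filter_upwards [h] with s hs
    simpa using hs
  refine hmax.hasDerivAt_eq_zero ?_
  simpa using (((hasDerivAt_sin 0).mul (hasDerivAt_cos 0)).const_mul β).fun_sub
    (((hasDerivAt_sin 0).pow 2).const_mul R)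

namespace IsSupportCurve

variable {K : Set Plane} {X : ℝ → Plane} {R R' θ : ℝ}

theorem inner_sub_unitVec_nonpos (hX : IsSupportCurve K X) (θ φ : ℝ) :
    ⟪X φ - X θ, unitVec θ⟫ ≤ 0 := by
  rw [inner_sub_left]; linarith [hX.inner_le θ _ (hX.mem φ)]

theorem inner_tangentVec_eq_zero_of_outside_larger_disk (hX : IsSupportCurve K X) (hRR : R < R')
    {c : Plane} (hc : ‖X θ - c‖ = R) (hball : ∀ᶠ φ in 𝓝 θ, ‖X φ - c‖ ≤ R)
    (hout : ∀ᶠ φ in 𝓝 θ, ⟪X θ, unitVec φ⟫ + R' * (1 - cos (φ - θ)) ≤ ⟪X φ, unitVec φ⟫) :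
    ⟪X θ - c, tangentVec θ⟫ = 0 := by
  have hR : 0 ≤ R := hc ▸ norm_nonneg _
  have hshift : Tendsto (fun s => θ + s) (𝓝 0) (𝓝 θ) :=
    Continuous.tendsto' (by fun_prop) _ _ (by simp)
  have hcos : ∀ᶠ s : ℝ in 𝓝 0, 0 < cos s :=
    continuous_cos.continuousAt.eventually_const_lt (by simp)
  refine eq_zero_of_eventually_mul_sin_mul_cos_le (R := R) ?_
  filter_upwards [hshift.eventually hball, hshift.eventually hout, hcos] with s hs hs' hcs
  refine tangential_mul_sin_mul_cos_le (d := X (θ + s) - X θ) (hR.trans_lt hRR) hc ?_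
    (hX.inner_sub_unitVec_nonpos θ _) ?_ hcs
  · rwa [add_comm, sub_add_sub_cancel]
  · rw [add_sub_cancel_left] at hs'
    rw [inner_sub_left]
    linarith

theorem not_eventually_outside_larger_disk (hX : IsSupportCurve K X) (hRR : R < R')
    (hloc : LocallyInDisk R X θ) :
    ¬∀ᶠ φ in 𝓝 θ, ⟪X θ, unitVec φ⟫ + R' * (1 - cos (φ - θ)) ≤ ⟪X φ, unitVec φ⟫ := by
  intro hout
  obtain ⟨c, hc, hball⟩ := hloc
  have hR : 0 ≤ R := hc ▸ norm_nonneg _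
  have hβ := hX.inner_tangentVec_eq_zero_of_outside_larger_disk hRR hc hball hout
  have hshift : Tendsto (fun s => θ + s) (𝓝 0) (𝓝 θ) :=
    Continuous.tendsto' (by fun_prop) _ _ (by simp)
  obtain ⟨s, ⟨hs, hs'⟩, hs0, hsπ⟩ := (((hshift.eventually (hball.and hout)).filter_mono
    nhdsWithin_le_nhds).and (Ioo_mem_nhdsGT pi_pos)).exists
  have hcos1 : cos s < 1 := by
    simpa using cos_lt_cos_of_nonneg_of_le_pi le_rfl hsπ.le hs0
  have hα : ⟪X θ - c, unitVec θ⟫ = R ∨ ⟪X θ - c, unitVec θ⟫ = -R := by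
    rw [← sq_eq_sq_iff_eq_or_eq_neg, ← hc, norm_sq_eq_frame _ θ, hβ]; ring
  rw [add_sub_cancel_left] at hs'
  rcases hα with hα | hα
  · have hin : ⟪X (θ + s) - c, unitVec (θ + s)⟫ ≤ R :=
      (real_inner_le_norm _ _).trans (by rwa [norm_unitVec, mul_one])
    have hframe := inner_unitVec_eq_frame (X θ - c) θ (θ + s)
    rw [hα, hβ, add_sub_cancel_left, inner_sub_left] at hframe
    rw [inner_sub_left] at hin
    nlinarith [mul_pos (sub_pos.2 hRR) (sub_pos.2 hcos1)]
  · have hsq : ‖X (θ + s) - X θ + (X θ - c)‖ ^ 2 ≤ R ^ 2 := by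
      rw [sub_add_sub_cancel]; gcongr
    rw [norm_add_sq_real, hc, inner_eq_frame _ _ θ, hα, hβ] at hsq
    have heq : X (θ + s) - X θ = 0 := by
      rw [← norm_eq_zero, ← sq_eq_zero_iff]
      exact le_antisymm (by nlinarith [hX.inner_sub_unitVec_nonpos θ (θ + s)]) (sq_nonneg _)
    rw [sub_eq_zero.1 heq] at hs'
    nlinarith [mul_pos (hR.trans_lt hRR) (sub_pos.2 hcos1)]

theorem not_eventually_disk_support_le (hX : IsSupportCurve K X) (hcont : Continuous X)
    (hRR : R < R') (hloc : LocallyInDisk R X θ) {c : Plane}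
    (heq : R' + ⟪c, unitVec θ⟫ = ⟪X θ, unitVec θ⟫) :
    ¬∀ᶠ φ in 𝓝 θ, R' + ⟪c, unitVec φ⟫ ≤ ⟪X φ, unitVec φ⟫ := by
  intro hle
  have hmin : IsLocalMin (fun φ => ⟪X φ, unitVec φ⟫ - ⟪c, unitVec φ⟫) θ := by
    filter_upwards [hle] with φ hφ
    linarith
  have hderiv := hmin.hasDerivAt_eq_zero
    ((hX.hasDerivAt_inner hcont θ).sub (hasDerivAt_inner_unitVec c θ))
  have hXc : X θ = c + R' • unitVec θ := by
    apply eq_of_inner_frame θ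
    · rw [inner_add_left, real_inner_smul_left, inner_unitVec_unitVec, sub_self, cos_zero]
      linarith
    · rw [inner_add_left, real_inner_smul_left, inner_unitVec_tangentVec, sub_self, sin_zero]
      linarith
  refine hX.not_eventually_outside_larger_disk hRR hloc ?_
  filter_upwards [hle] with φ hφ
  rw [hXc, inner_add_left, real_inner_smul_left, real_inner_comm (unitVec φ) (unitVec θ),
    inner_unitVec_unitVec]
  linarith

theorem inner_le_of_locallyInDisk_of_lt (hX : IsSupportCurve K X) (hcont : Continuous X)
    (hRR : R < R') (hloc : ∀ φ, LocallyInDisk R X φ) {T : ℝ} (hT : |T| < π) :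
    ⟪X (θ + T), unitVec (θ + T)⟫ ≤ ⟪X θ, unitVec (θ + T)⟫ + R' * (1 - cos T) := by
  set G : ℝ → ℝ := fun t =>
    ⟪X (θ + t), unitVec (θ + t)⟫ - ⟪X θ, unitVec (θ + t)⟫ - R' * (1 - cos t) with hG
  have hderiv : HasDerivAt G 0 0 := by
    have hh : HasDerivAt (fun t => ⟪X (θ + t), unitVec (θ + t)⟫) ⟪X θ, tangentVec θ⟫ 0 :=
      HasDerivAt.comp_const_add θ 0 (by simpa using hX.hasDerivAt_inner hcont θ)
    have hp : HasDerivAt (fun t => ⟪X θ, unitVec (θ + t)⟫) ⟪X θ, tangentVec θ⟫ 0 :=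
      HasDerivAt.comp_const_add θ 0 (by simpa using hasDerivAt_inner_unitVec (X θ) θ)
    simpa using (hh.fun_sub hp).fun_sub (((hasDerivAt_cos 0).const_sub 1).const_mul R')
  suffices G T ≤ 0 by simp only [hG] at this; linarith
  refine nonpos_of_not_touched_by_sinusoid_of_abs_lt_pi (by fun_prop) (by simp [G]) hderiv
    (fun t A B heq htouch => ?_) hT
  -- `G` touched by the sinusoid means `K` touched by the disk of radius `R'` with center `c`.
  set c := X θ - R' • unitVec θ + A • unitVec θ + B • tangentVec θ with hc
  have hsupport (s : ℝ) : R' + ⟪c, unitVec (θ + s)⟫ =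
      ⟪X (θ + s), unitVec (θ + s)⟫ - (G s - (A * cos s + B * sin s)) := by
    simp only [hc, hG, inner_add_left, inner_sub_left, real_inner_smul_left, inner_unitVec_unitVec,
      inner_tangentVec_unitVec, add_sub_cancel_left, sub_add_cancel_left, cos_neg]
    ring
  refine hX.not_eventually_disk_support_le hcont hRR (hloc (θ + t)) (c := c)
    (by rw [hsupport, heq]; ring) ?_
  have hshift : Tendsto (fun φ => φ - θ) (𝓝 (θ + t)) (𝓝 t) :=
    Continuous.tendsto' (by fun_prop) _ _ (by simp)
  filter_upwards [hshift.eventually htouch] with φ hφ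
  have hsup := hsupport (φ - θ)
  rw [add_sub_cancel] at hsup
  linarith

theorem inner_le_of_locallyInDisk (hX : IsSupportCurve K X) (hcont : Continuous X)
    (hloc : ∀ φ, LocallyInDisk R X φ) {T : ℝ} (hT : T ∈ Icc (-π) π) :
    ⟪X (θ + T), unitVec (θ + T)⟫ ≤ ⟪X θ, unitVec (θ + T)⟫ + R * (1 - cos T) := by
  have hopen : ∀ T ∈ Ioo (-π) π,
      ⟪X (θ + T), unitVec (θ + T)⟫ ≤ ⟪X θ, unitVec (θ + T)⟫ + R * (1 - cos T) := by
    intro T hT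
    have hlim : Tendsto (fun R' => ⟪X θ, unitVec (θ + T)⟫ + R' * (1 - cos T)) (𝓝[>] R)
        (𝓝 (⟪X θ, unitVec (θ + T)⟫ + R * (1 - cos T))) :=
      (Continuous.tendsto (by fun_prop) R).mono_left nhdsWithin_le_nhds
    refine ge_of_tendsto hlim ?_
    filter_upwards [self_mem_nhdsWithin] with R' hR'
    exact hX.inner_le_of_locallyInDisk_of_lt hcont hR' hloc (abs_lt.2 hT)
  have hclosed : IsClosed {T : ℝ | ⟪X (θ + T), unitVec (θ + T)⟫ ≤
      ⟪X θ, unitVec (θ + T)⟫ + R * (1 - cos T)} := isClosed_le (by fun_prop) (by fun_prop)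
  have := closure_minimal hopen hclosed
  rw [closure_Ioo (by linarith [pi_pos])] at this
  exact this hT

theorem subset_closedBall_of_locallyInDisk (hX : IsSupportCurve K X) (hcont : Continuous X)
    (hloc : ∀ φ, LocallyInDisk R X φ) (θ : ℝ) :
    K ⊆ Metric.closedBall (X θ - R • unitVec θ) R := by
  intro y hy
  rw [mem_closedBall_iff_norm]
  set w := y - (X θ - R • unitVec θ) with hw
  obtain ⟨φ, hφ, hwφ⟩ := exists_eq_norm_smul_unitVec w (θ - π)
  have hinner : ⟪w, unitVec φ⟫ ≤ R := by
    have h := hX.inner_le_of_locallyInDisk hcont hloc (θ := θ) (T := φ - θ)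
      ⟨by linarith [hφ.1], by linarith [hφ.2]⟩
    rw [add_sub_cancel] at h
    rw [hw, inner_sub_left, inner_sub_left, real_inner_smul_left,
      real_inner_comm (unitVec φ) (unitVec θ), inner_unitVec_unitVec]
    linarith [hX.inner_le φ y hy]
  rwa [hwφ, real_inner_smul_left, inner_unitVec_unitVec, sub_self, cos_zero, mul_one] at hinner

end IsSupportCurve

/-- A support curve of `K` such that at each of its points `K` is contained in the disk of radius
`R` tangent there from outside, so that `K` rolls freely inside a disk of radius `R`. -/
structure IsRollingCurve (R : ℝ) (K : Set Plane) (X : ℝ → Plane) : Prop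
    extends IsSupportCurve K X where
  pos : 0 < R
  subset_closedBall : ∀ θ, K ⊆ Metric.closedBall (X θ - R • unitVec θ) R

namespace IsLambdaConvexBody

variable {lam : ℝ} {K : Set Plane} {X : ℝ → Plane}

theorem nonempty (hK : IsLambdaConvexBody lam K) : K.Nonempty :=
  hK.interior_nonempty.mono interior_subset

/-- The midpoint of a boundary segment would be the midpoint of a chord of its supporting disk, yet
lie on the circle. -/
theorem eq_of_segment_subset_frontier (hK : IsLambdaConvexBody lam K) {x y : Plane}
    (hxy : ∀ s ∈ Icc (0 : ℝ) 1, x + s • (y - x) ∈ frontier K) : y = x := by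
  by_contra hne
  obtain ⟨U, hU, c, hc, hUc⟩ := hK.locally_supported _ (hxy (1 / 2) (by norm_num))
  have hlim (σ : ℝ) : Tendsto (fun t : ℝ => x + (1 / 2 + σ * t) • (y - x)) (𝓝[>] 0)
      (𝓝 (x + (1 / 2 : ℝ) • (y - x))) :=
    (Continuous.tendsto' (by fun_prop) _ _ (by simp)).mono_left nhdsWithin_le_nhds
  obtain ⟨t, ⟨hU₁, hU₂⟩, ht0, ht⟩ := ((((hlim 1).eventually hU).and ((hlim (-1)).eventually hU)).and
    (Ioo_mem_nhdsGT (show (0 : ℝ) < 1 / 2 by norm_num))).exists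
  have hb₁ := hUc ⟨hU₁, hxy _ ⟨by linarith, by linarith⟩⟩
  have hb₂ := hUc ⟨hU₂, hxy _ ⟨by linarith, by linarith⟩⟩
  rw [mem_closedBall_iff_norm] at hb₁ hb₂
  rw [mem_sphere_iff_norm] at hc
  set m := x + (1 / 2 : ℝ) • (y - x) - c with hm
  set v := t • (y - x) with hv
  have h₁ : x + (1 / 2 + 1 * t) • (y - x) - c = m + v := by rw [hm, hv]; module
  have h₂ : x + (1 / 2 + -1 * t) • (y - x) - c = m - v := by rw [hm, hv]; module
  rw [h₁] at hb₁
  rw [h₂] at hb₂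
  have hvpos : 0 < ‖v‖ := norm_pos_iff.2 (smul_ne_zero ht0.ne' (sub_ne_zero.2 hne))
  have hparallelogram := parallelogram_law_with_norm ℝ m v
  rw [hc] at hparallelogram
  linarith [mul_self_le_mul_self (norm_nonneg _) hb₁, mul_self_le_mul_self (norm_nonneg _) hb₂,
    mul_pos hvpos hvpos]

theorem eq_of_inner_eq (hK : IsLambdaConvexBody lam K) (hX : IsSupportCurve K X) (θ : ℝ)
    {y : Plane} (hy : y ∈ K) (heq : ⟪y, unitVec θ⟫ = ⟪X θ, unitVec θ⟫) : y = X θ := by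
  refine hK.eq_of_segment_subset_frontier fun s hs => mem_frontier_of_forall_inner_le (θ := θ)
    (hK.convex.add_smul_sub_mem (hX.mem θ) hy hs) fun z hz => ?_
  rw [inner_add_left, real_inner_smul_left, inner_sub_left, heq, sub_self, mul_zero, add_zero]
  exact hX.inner_le θ z hz

theorem continuous_supportCurve (hK : IsLambdaConvexBody lam K) (hX : IsSupportCurve K X) :
    Continuous X :=
  hX.continuous_of_unique hK.isCompact fun θ _ hy heq => hK.eq_of_inner_eq hX θ hy heq

theorem locallyInDisk (hK : IsLambdaConvexBody lam K) (hX : IsSupportCurve K X) (θ : ℝ) :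
    LocallyInDisk (1 / lam) X θ := by
  obtain ⟨U, hU, c, hc, hUc⟩ := hK.locally_supported _ (hX.mem_frontier θ)
  refine ⟨c, mem_sphere_iff_norm.1 hc, ?_⟩
  filter_upwards [((hK.continuous_supportCurve hX).tendsto θ).eventually hU] with φ hφ
  exact mem_closedBall_iff_norm.1 (hUc ⟨hφ, hX.mem_frontier φ⟩)

theorem exists_isRollingCurve (hK : IsLambdaConvexBody lam K) (hlam : 0 < lam) :
    ∃ X, IsRollingCurve (1 / lam) K X := by
  obtain ⟨X, hX⟩ := exists_isSupportCurve_of_isCompact hK.isCompact hK.nonempty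
  exact ⟨X, hX, one_div_pos.2 hlam,
    hX.subset_closedBall_of_locallyInDisk (hK.continuous_supportCurve hX) (hK.locallyInDisk hX)⟩

end IsLambdaConvexBody

/-! ### Rolling curves and the radius of curvature -/

theorem intervalIntegrable_of_bounded {f : ℝ → ℝ} {C : ℝ} (hf : Measurable f)
    (hC : ∀ x, |f x| ≤ C) (a b : ℝ) : IntervalIntegrable f volume a b := by
  rw [intervalIntegrable_iff]
  exact Measure.integrableOn_of_bounded (M := C) (by simp) hf.aestronglyMeasurable
    (Eventually.of_forall hC)

theorem exists_forall_inner_unitVec_le {K : Set Plane} (hK : Convex ℝ K)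
    (hint : (interior K).Nonempty) {p : Plane} (hp : p ∉ interior K) (a : ℝ) :
    ∃ θ ∈ Ico a (a + 2 * π), ∀ y ∈ K, ⟪y, unitVec θ⟫ ≤ ⟪p, unitVec θ⟫ := by
  obtain ⟨f, hf⟩ := geometric_hahn_banach_open_point hK.interior isOpen_interior hp
  have hle : ∀ y ∈ K, f y ≤ f p := by
    have hclosure : closure (interior K) ⊆ {y | f y ≤ f p} :=
      closure_minimal (fun y hy => (hf y hy).le) (isClosed_le f.continuous continuous_const)
    rw [hK.closure_interior_eq_closure_of_nonempty_interior hint] at hclosure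
    exact fun y hy => hclosure (subset_closure hy)
  set w := (InnerProductSpace.toDual ℝ Plane).symm f with hw
  have hfw (y : Plane) : f y = ⟪y, w⟫ := by
    rw [real_inner_comm, hw, InnerProductSpace.toDual_symm_apply]
  have hwpos : 0 < ‖w‖ := by
    obtain ⟨y, hy⟩ := hint
    rw [norm_pos_iff]
    rintro h0
    simpa [hfw, h0] using hf y hy
  obtain ⟨θ, hθ, hθw⟩ := exists_eq_norm_smul_unitVec w a
  refine ⟨θ, hθ, fun y hy => le_of_mul_le_mul_left ?_ hwpos⟩
  simpa only [hfw, ← real_inner_smul_right, ← hθw] using hle y hy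

namespace IsRollingCurve

variable {R : ℝ} {K : Set Plane} {X : ℝ → Plane}

theorem sq_norm_sub_le (hX : IsRollingCurve R K X) (θ : ℝ) {y : Plane} (hy : y ∈ K) :
    ‖y - X θ‖ ^ 2 + 2 * R * ⟪y - X θ, unitVec θ⟫ ≤ 0 := by
  have hR := hX.pos
  have hball := mem_closedBall_iff_norm.1 (hX.subset_closedBall θ hy)
  rw [← sub_add] at hball
  have hsq : ‖(y - X θ) + R • unitVec θ‖ ^ 2 ≤ R ^ 2 := by gcongr
  rw [norm_add_sq_real, norm_smul, norm_unitVec, real_inner_smul_right, norm_of_nonneg hR.le] at hsq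
  linarith

theorem eq_of_inner_eq (hX : IsRollingCurve R K X) (θ : ℝ) {y : Plane} (hy : y ∈ K)
    (h : ⟪y, unitVec θ⟫ = ⟪X θ, unitVec θ⟫) : y = X θ := by
  have hle := hX.sq_norm_sub_le θ hy
  rw [inner_sub_left, h, sub_self, mul_zero, add_zero] at hle
  exact norm_sub_eq_zero_iff.1 (sq_eq_zero_iff.1 (le_antisymm hle (sq_nonneg _)))

theorem periodic (hX : IsRollingCurve R K X) : Function.Periodic X (2 * π) := by
  refine fun θ => hX.eq_of_inner_eq θ (hX.mem _) (le_antisymm (hX.inner_le _ _ (hX.mem _)) ?_)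
  simpa only [unitVec_add_two_pi] using hX.inner_le (θ + 2 * π) _ (hX.mem θ)

theorem norm_sub_le (hX : IsRollingCurve R K X) (a b : ℝ) : ‖X a - X b‖ ≤ R * |a - b| := by
  have hR := hX.pos
  have hab := hX.sq_norm_sub_le b (hX.mem a)
  have hba := hX.sq_norm_sub_le a (hX.mem b)
  rw [← neg_sub (X a) (X b), norm_neg, inner_neg_left] at hba
  rcases (norm_nonneg (X a - X b)).eq_or_lt with h0 | h0
  · rw [← h0]; positivity
  refine le_of_mul_le_mul_left ?_ h0
  calc ‖X a - X b‖ * ‖X a - X b‖ ≤ R * ⟪X a - X b, unitVec a - unitVec b⟫ := by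
        rw [inner_sub_right]; linarith
    _ ≤ R * (‖X a - X b‖ * ‖unitVec a - unitVec b‖) := by gcongr; exact real_inner_le_norm _ _
    _ ≤ R * (‖X a - X b‖ * |a - b|) := by gcongr; exact norm_unitVec_sub_le a b
    _ = ‖X a - X b‖ * (R * |a - b|) := by ring

theorem lipschitzWith (hX : IsRollingCurve R K X) : LipschitzWith R.toNNReal X :=
  LipschitzWith.of_dist_le_mul fun a b => by
    rw [dist_eq_norm, dist_eq, coe_toNNReal _ hX.pos.le]
    exact hX.norm_sub_le a b

theorem continuous (hX : IsRollingCurve R K X) : Continuous X :=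
  hX.lipschitzWith.continuous

theorem curvRadius_le (hX : IsRollingCurve R K X) (θ : ℝ) : curvRadius X θ ≤ R := by
  have hderiv := norm_deriv_le_of_lipschitz hX.lipschitzWith (x₀ := θ)
  rw [coe_toNNReal _ hX.pos.le] at hderiv
  refine (real_inner_le_norm _ _).trans ?_
  rwa [norm_tangentVec, mul_one]

theorem intervalIntegrable_curvRadius (hX : IsRollingCurve R K X) (a b : ℝ) :
    IntervalIntegrable (curvRadius X) volume a b :=
  intervalIntegrable_of_bounded (measurable_curvRadius X)
    (fun θ => (abs_of_nonneg (hX.curvRadius_nonneg θ)).trans_le (hX.curvRadius_le θ)) a b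

theorem intervalIntegrable_curvRadius_mul (hX : IsRollingCurve R K X) {g : ℝ → ℝ}
    (hg : Continuous g) (a b : ℝ) :
    IntervalIntegrable (fun θ => curvRadius X θ * g θ) volume a b :=
  (hX.intervalIntegrable_curvRadius a b).mul_continuousOn hg.continuousOn

theorem inner_sub_eq_integral (hX : IsRollingCurve R K X) (w : Plane) (a b : ℝ) :
    ⟪X b - X a, w⟫ = ∫ t in a..b, curvRadius X t * ⟪tangentVec t, w⟫ := by
  have hlip : LipschitzWith (R.toNNReal * ‖w‖₊) (fun t => ⟪X t, w⟫) :=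
    LipschitzWith.of_dist_le_mul fun s t => by
      rw [dist_eq, ← inner_sub_left, NNReal.coe_mul, mul_right_comm, coe_nnnorm]
      refine (abs_real_inner_le_norm _ _).trans ?_
      gcongr
      rw [← dist_eq_norm]
      exact hX.lipschitzWith.dist_le_mul s t
  rw [inner_sub_left, ←
    (hlip.lipschitzOnWith (s := uIcc a b)).absolutelyContinuousOnInterval.integral_deriv_eq_sub]
  apply intervalIntegral.integral_congr_ae
  filter_upwards [hX.lipschitzWith.ae_differentiableAt_real] with t ht _
  have hderiv : HasDerivAt (fun s => ⟪X s, w⟫) ⟪deriv X t, w⟫ t := by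
    simpa using ht.hasDerivAt.inner ℝ (hasDerivAt_const t w)
  rw [hderiv.deriv, hX.deriv_eq, real_inner_smul_left]

theorem norm_sub_le_integral (hX : IsRollingCurve R K X) {a b : ℝ} (hab : a ≤ b) :
    ‖X b - X a‖ ≤ ∫ t in a..b, curvRadius X t := by
  rcases (norm_nonneg (X b - X a)).eq_or_lt with h0 | h0
  · rw [← h0]
    exact intervalIntegral.integral_nonneg hab fun t _ => hX.curvRadius_nonneg t
  refine le_of_mul_le_mul_right ?_ h0
  calc ‖X b - X a‖ * ‖X b - X a‖ = ∫ t in a..b, curvRadius X t * ⟪tangentVec t, X b - X a⟫ := by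
        rw [← real_inner_self_eq_norm_mul_norm, hX.inner_sub_eq_integral]
    _ ≤ ∫ t in a..b, curvRadius X t * ‖X b - X a‖ := by
        refine intervalIntegral.integral_mono_on hab
          (hX.intervalIntegrable_curvRadius_mul (by fun_prop) a b)
          (hX.intervalIntegrable_curvRadius_mul continuous_const a b) fun t _ => ?_
        refine mul_le_mul_of_nonneg_left ?_ (hX.curvRadius_nonneg t)
        simpa only [norm_tangentVec, one_mul] using real_inner_le_norm (tangentVec t) (X b - X a)
    _ = (∫ t in a..b, curvRadius X t) * ‖X b - X a‖ := intervalIntegral.integral_mul_const _ _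

theorem cos_mul_integral_le (hX : IsRollingCurve R K X) {a b ε : ℝ} (hab : a ≤ b)
    (hb : b ≤ a + ε) (hε : ε ≤ π) :
    cos ε * ∫ t in a..b, curvRadius X t ≤ ⟪X b - X a, tangentVec a⟫ := by
  rw [hX.inner_sub_eq_integral, mul_comm, ← intervalIntegral.integral_mul_const]
  refine intervalIntegral.integral_mono_on hab
    (hX.intervalIntegrable_curvRadius_mul continuous_const a b)
    (hX.intervalIntegrable_curvRadius_mul (by fun_prop) a b) fun t ht => ?_
  refine mul_le_mul_of_nonneg_left ?_ (hX.curvRadius_nonneg t)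
  rw [inner_tangentVec_tangentVec]
  exact cos_le_cos_of_nonneg_of_le_pi (by linarith [ht.1]) hε (by linarith [ht.2])

theorem eq_of_eq (hX : IsRollingCurve R K X) {a b t : ℝ} (hab : b < a + π)
    (h : X a = X b) (ht : t ∈ Icc a b) : X t = X a := by
  rcases ht.1.eq_or_lt with h0 | h0
  · rw [h0]
  symm
  refine hX.eq_of_inner_eq t (hX.mem a) (le_antisymm (hX.inner_le t _ (hX.mem a)) ?_)
  have hs : 0 < sin (b - a) := sin_pos_of_pos_of_lt_pi (by linarith [ht.2]) (by linarith)
  have hsb : 0 ≤ sin (b - t) :=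
    sin_nonneg_of_nonneg_of_le_pi (by linarith [ht.2]) (by linarith [ht.1])
  have hsa : 0 ≤ sin (t - a) := sin_nonneg_of_nonneg_of_le_pi (by linarith) (by linarith [ht.2])
  have hb := hX.inner_le b _ (hX.mem t)
  rw [← h] at hb
  refine le_of_mul_le_mul_left ?_ hs
  rw [sin_mul_inner_unitVec, sin_mul_inner_unitVec (X a)]
  gcongr
  exact hX.inner_le a _ (hX.mem t)

theorem frontier_eq (hX : IsRollingCurve R K X) (hKc : IsClosed K) (hconv : Convex ℝ K)
    (hint : (interior K).Nonempty) (a : ℝ) : frontier K = X '' Ico a (a + 2 * π) := by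
  refine Subset.antisymm (fun p hp => ?_) (image_subset_iff.2 fun θ _ => hX.mem_frontier θ)
  have hpK : p ∈ K := hKc.frontier_subset hp
  obtain ⟨θ, hθ, hle⟩ := exists_forall_inner_unitVec_le hconv hint hp.2 a
  exact ⟨θ, hθ, (hX.eq_of_inner_eq θ hpK
    (le_antisymm (hX.inner_le θ _ hpK) (hle _ (hX.mem θ)))).symm⟩

end IsRollingCurve


/-! ### Perimeter -/

theorem hausdorffMeasure_image_le_of_dist_le {ι Y Z : Type*} [MetricSpace Y] [MeasurableSpace Y]
    [BorelSpace Y] [MetricSpace Z] [MeasurableSpace Z] [BorelSpace Z] {f : ι → Y} {g : ι → Z}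
    {A : Set ι} (h : ∀ s ∈ A, ∀ t ∈ A, dist (f s) (f t) ≤ dist (g s) (g t)) {d : ℝ} (hd : 0 ≤ d) :
    μH[d] (f '' A) ≤ μH[d] (g '' A) := by
  rcases A.eq_empty_or_nonempty with rfl | ⟨x, -⟩
  · simp
  have : Nonempty ι := ⟨x⟩
  set T := Function.invFunOn g A
  have hTmem : ∀ z ∈ g '' A, T z ∈ A := fun z hz => Function.invFunOn_mem hz
  have hTeq : ∀ z ∈ g '' A, g (T z) = z := fun z hz => Function.invFunOn_eq hz
  have hlip : LipschitzOnWith 1 (f ∘ T) (g '' A) :=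
    LipschitzOnWith.of_dist_le_mul fun z hz w hw => by
      have hle := h _ (hTmem z hz) _ (hTmem w hw)
      rw [hTeq z hz, hTeq w hw] at hle
      simpa using hle
  have hfactor : f '' A ⊆ (f ∘ T) '' (g '' A) := by
    rintro _ ⟨s, hs, rfl⟩
    have hgs : g s ∈ g '' A := mem_image_of_mem g hs
    have hle := h _ (hTmem _ hgs) _ hs
    rw [hTeq _ hgs, dist_self] at hle
    exact ⟨g s, hgs, dist_le_zero.1 hle⟩
  calc μH[d] (f '' A) ≤ μH[d] ((f ∘ T) '' (g '' A)) := measure_mono hfactor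
    _ ≤ (1 : NNReal) ^ d * μH[d] (g '' A) := hlip.hausdorffMeasure_image_le hd
    _ = μH[d] (g '' A) := by simp

namespace IsRollingCurve

variable {R : ℝ} {K : Set Plane} {X : ℝ → Plane}

theorem perimeter_le (hX : IsRollingCurve R K X) (hKc : IsClosed K) (hconv : Convex ℝ K)
    (hint : (interior K).Nonempty) (a : ℝ) :
    perimeter K ≤ ENNReal.ofReal (∫ t in a..a + 2 * π, curvRadius X t) := by
  rw [perimeter, hX.frontier_eq hKc hconv hint a]
  set S : ℝ → ℝ := fun θ => ∫ t in a..θ, curvRadius X t with hS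
  have hsub (s t : ℝ) : S t - S s = ∫ x in s..t, curvRadius X x :=
    intervalIntegral.integral_interval_sub_left (hX.intervalIntegrable_curvRadius _ _)
      (hX.intervalIntegrable_curvRadius _ _)
  have hmono : Monotone S := fun s t hst => sub_nonneg.1 <| by
    rw [hsub]
    exact intervalIntegral.integral_nonneg hst fun x _ => hX.curvRadius_nonneg x
  have hdist (s t : ℝ) : dist (X s) (X t) ≤ dist (S s) (S t) := by
    wlog hst : s ≤ t generalizing s t
    · rw [dist_comm, dist_comm (S s)]
      exact this t s (le_of_not_ge hst)
    rw [dist_comm, dist_eq_norm, dist_comm, dist_eq, abs_of_nonneg (sub_nonneg.2 (hmono hst)), hsub]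
    exact hX.norm_sub_le_integral hst
  have hrange : S '' Ico a (a + 2 * π) ⊆ Icc 0 (S (a + 2 * π)) := by
    rintro _ ⟨s, hs, rfl⟩
    have ha : S a = 0 := by simp [hS]
    exact ⟨ha ▸ hmono hs.1, hmono hs.2.le⟩
  calc μH[1] (X '' Ico a (a + 2 * π)) ≤ μH[1] (S '' Ico a (a + 2 * π)) :=
        hausdorffMeasure_image_le_of_dist_le (fun s _ t _ => hdist s t) zero_le_one
    _ ≤ volume (Icc 0 (S (a + 2 * π))) := by
        rw [hausdorffMeasure_real]
        exact measure_mono hrange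
    _ = ENNReal.ofReal (S (a + 2 * π)) := by rw [volume_Icc, sub_zero]

theorem ne_add_pi (hX : IsRollingCurve R K X) (hint : (interior K).Nonempty) (s : ℝ) :
    X s ≠ X (s + π) := by
  intro heq
  have hsub : K ⊆ {X s} := fun y hy => by
    refine hX.eq_of_inner_eq s hy (le_antisymm (hX.inner_le s y hy) ?_)
    have hle := hX.inner_le (s + π) y hy
    rw [← heq, unitVec_add_pi, inner_neg_right, inner_neg_right] at hle
    linarith
  simpa using hint.mono (interior_mono hsub)

theorem ofReal_inner_le_hausdorffMeasure (hX : IsRollingCurve R K X) {a b : ℝ} (hab : a ≤ b)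
    (c : ℝ) : ENNReal.ofReal ⟪X b - X a, tangentVec c⟫ ≤ μH[1] (X '' Icc a b) := by
  have hcont : ContinuousOn (fun t => ⟪X t, tangentVec c⟫) (Icc a b) := by
    have := hX.continuous
    fun_prop
  calc ENNReal.ofReal ⟪X b - X a, tangentVec c⟫
      = volume (Icc ⟪X a, tangentVec c⟫ ⟪X b, tangentVec c⟫) := by
        rw [volume_Icc, inner_sub_left]
    _ ≤ volume ((fun t => ⟪X t, tangentVec c⟫) '' Icc a b) :=
        measure_mono (intermediate_value_Icc hab hcont)
    _ = μH[1] ((fun t => ⟪X t, tangentVec c⟫) '' Icc a b) := by rw [hausdorffMeasure_real]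
    _ ≤ μH[1] (X '' Icc a b) := by
        refine hausdorffMeasure_image_le_of_dist_le (fun s _ t _ => ?_) zero_le_one
        rw [dist_eq, ← inner_sub_left, dist_eq_norm]
        refine (abs_real_inner_le_norm _ _).trans ?_
        rw [norm_tangentVec, mul_one]

/-- Two arcs that do not overlap in angle meet at most in the endpoints of the second one. -/
theorem aedisjoint_image_Icc (hX : IsRollingCurve R K X) (hint : (interior K).Nonempty)
    {s t s' t' : ℝ} (hts' : t ≤ s') (ht' : t' ≤ s + 2 * π) :
    AEDisjoint μH[1] (X '' Icc s t) (X '' Icc s' t') := by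
  have hsub : X '' Icc s t ∩ X '' Icc s' t' ⊆ {X s', X t'} := by
    rintro _ ⟨⟨u, hu, rfl⟩, v, hv, hvu⟩
    rcases lt_trichotomy v (u + π) with h | h | h
    · exact Or.inl (hX.eq_of_eq h hvu.symm ⟨hu.2.trans hts', hv.1⟩).symm
    · exact absurd (h ▸ hvu.symm) (hX.ne_add_pi hint u)
    · have hv' : X v = X (u + 2 * π) := by rw [hX.periodic, hvu]
      have ht'v := hX.eq_of_eq (by linarith) hv' ⟨hv.2, by linarith [hu.1]⟩
      exact Or.inr (by rw [mem_singleton_iff, ht'v, hvu])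
  have := Measure.nullSingletonClass_hausdorff Plane zero_lt_one
  exact measure_mono_null hsub ((toFinite _).measure_zero _)

theorem sum_hausdorffMeasure_le_perimeter (hX : IsRollingCurve R K X)
    (hint : (interior K).Nonempty) {θ : ℕ → ℝ} (hθ : Monotone θ) {N : ℕ}
    (hN : θ N ≤ θ 0 + 2 * π) :
    ∑ i ∈ Finset.range N, μH[1] (X '' Icc (θ i) (θ (i + 1))) ≤ perimeter K := by
  have hdisj {i j : ℕ} (hij : i < j) (hj : j < N) : AEDisjoint μH[1] (X '' Icc (θ i) (θ (i + 1)))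
      (X '' Icc (θ j) (θ (j + 1))) :=
    hX.aedisjoint_image_Icc hint (hθ hij)
      (by linarith [hθ (Nat.zero_le i), hθ (Nat.succ_le_of_lt hj)])
  rw [← measure_biUnion_finset₀]
  · exact measure_mono (iUnion₂_subset fun i _ => image_subset_iff.2 fun t _ => hX.mem_frontier t)
  · intro i hi j hj hij
    rw [Finset.mem_coe, Finset.mem_range] at hi hj
    rcases lt_or_gt_of_ne hij with h | h
    · exact hdisj h hj
    · exact (hdisj h hi).symm
  · exact fun i _ => (isCompact_Icc.image hX.continuous).measurableSet.nullMeasurableSet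

theorem cos_mul_integral_le_perimeter (hX : IsRollingCurve R K X) (hint : (interior K).Nonempty)
    (a : ℝ) {N : ℕ} (hN : 2 ≤ N) :
    ENNReal.ofReal (cos (2 * π / N) * ∫ t in a..a + 2 * π, curvRadius X t) ≤ perimeter K := by
  set ε := 2 * π / N with hε
  have hN' : (2 : ℝ) ≤ N := by exact_mod_cast hN
  have hεπ : ε ≤ π := by
    rw [hε, div_le_iff₀ (by positivity)]
    nlinarith [pi_pos]
  set θ : ℕ → ℝ := fun i => a + i * ε with hθ
  have hsucc (i : ℕ) : θ (i + 1) = θ i + ε := by simp only [hθ]; push_cast; ring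
  have hmono : Monotone θ := monotone_nat_of_le_succ fun i => by
    rw [hsucc]
    exact le_add_of_nonneg_right (by positivity)
  have hθ0 : θ 0 = a := by simp [hθ]
  have hθN : θ N = a + 2 * π := by simp only [hθ, hε]; field_simp
  have hchords : cos ε * ∫ t in a..a + 2 * π, curvRadius X t ≤
      ∑ i ∈ Finset.range N, ⟪X (θ (i + 1)) - X (θ i), tangentVec (θ i)⟫ := by
    rw [← hθN, ← hθ0, ← intervalIntegral.sum_integral_adjacent_intervals
      (fun k _ => hX.intervalIntegrable_curvRadius _ _), Finset.mul_sum]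
    exact Finset.sum_le_sum fun i _ =>
      hX.cos_mul_integral_le (hmono (Nat.le_succ i)) (hsucc i).le hεπ
  calc _ ≤ ENNReal.ofReal (∑ i ∈ Finset.range N, ⟪X (θ (i + 1)) - X (θ i), tangentVec (θ i)⟫) :=
        ENNReal.ofReal_le_ofReal hchords
    _ ≤ ∑ i ∈ Finset.range N, ENNReal.ofReal ⟪X (θ (i + 1)) - X (θ i), tangentVec (θ i)⟫ :=
        Finset.le_sum_of_subadditive _ ENNReal.ofReal_zero.le (fun _ _ => ENNReal.ofReal_add_le) _ _
    _ ≤ ∑ i ∈ Finset.range N, μH[1] (X '' Icc (θ i) (θ (i + 1))) :=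
        Finset.sum_le_sum fun i _ =>
          hX.ofReal_inner_le_hausdorffMeasure (hmono (Nat.le_succ i)) _
    _ ≤ perimeter K := hX.sum_hausdorffMeasure_le_perimeter hint hmono (by rw [hθN, hθ0])

theorem perimeter_eq (hX : IsRollingCurve R K X) (hKc : IsClosed K) (hconv : Convex ℝ K)
    (hint : (interior K).Nonempty) (a : ℝ) :
    perimeter K = ENNReal.ofReal (∫ t in a..a + 2 * π, curvRadius X t) := by
  refine le_antisymm (hX.perimeter_le hKc hconv hint a) ?_
  have hlim : Tendsto (fun N : ℕ => ENNReal.ofReal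
      (cos (2 * π / N) * ∫ t in a..a + 2 * π, curvRadius X t)) atTop
      (𝓝 (ENNReal.ofReal (∫ t in a..a + 2 * π, curvRadius X t))) := by
    refine ENNReal.tendsto_ofReal ?_
    have hcos := (continuous_cos.tendsto 0).comp (tendsto_const_div_atTop_nhds_zero_nat (2 * π))
    simpa using hcos.mul_const (∫ t in a..a + 2 * π, curvRadius X t)
  refine le_of_tendsto hlim ?_
  filter_upwards [eventually_ge_atTop 2] with N hN
  exact hX.cos_mul_integral_le_perimeter hint a hN

end IsRollingCurve

/-! ### Chord comparison for the sine -/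

/-- The excess of `sin` at `g` over the chord of `sin` through `δ` and `π - ℓ + δ`. -/
noncomputable def sinChordDefect (ℓ δ g : ℝ) : ℝ :=
  sin g - sin δ - (π - ℓ)⁻¹ * ((g - δ) * (sin (ℓ - δ) - sin δ))

theorem sinChordDefect_pos {ℓ δ g : ℝ} (hδ : 0 ≤ δ) (hδℓ : δ ≤ ℓ) (hg : δ < g)
    (hg' : g < π - ℓ + δ) : 0 < sinChordDefect ℓ δ g := by
  have hℓ : 0 < π - ℓ := by linarith
  have hconcave := strictConcaveOn_sin_Icc.2 (show δ ∈ Icc 0 π from ⟨hδ, by linarith⟩)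
    (show π - ℓ + δ ∈ Icc 0 π from ⟨by linarith, by linarith⟩) (by linarith)
    (show 0 < 1 - (π - ℓ)⁻¹ * (g - δ) by rw [sub_pos, inv_mul_lt_iff₀ hℓ]; linarith)
    (show 0 < (π - ℓ)⁻¹ * (g - δ) from mul_pos (inv_pos.2 hℓ) (sub_pos.2 hg)) (by ring)
  have hcombination :
      (1 - (π - ℓ)⁻¹ * (g - δ)) * δ + (π - ℓ)⁻¹ * (g - δ) * (π - ℓ + δ) = g := by
    field_simp
    ring
  have hendpoint : sin (π - ℓ + δ) = sin (ℓ - δ) := by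
    rw [← sin_pi_sub (ℓ - δ)]
    congr 1
    ring
  simp only [smul_eq_mul] at hconcave
  rw [hcombination, hendpoint] at hconcave
  rw [sinChordDefect]
  linarith

theorem sinChordDefect_nonneg {ℓ δ g : ℝ} (hδ : 0 ≤ δ) (hδℓ : δ ≤ ℓ) (hg : δ ≤ g)
    (hg' : g ≤ π - ℓ + δ) : 0 ≤ sinChordDefect ℓ δ g := by
  rcases hg.eq_or_lt with rfl | hlt
  · simp [sinChordDefect]
  rcases hg'.eq_or_lt with rfl | hlt'
  · have hℓ : π - ℓ ≠ 0 := by linarith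
    rw [sinChordDefect, add_sub_cancel_right, inv_mul_cancel_left₀ hℓ, sub_add, sin_pi_sub,
      sub_self]
  · exact (sinChordDefect_pos hδ hδℓ hlt hlt').le

theorem eq_or_eq_of_sinChordDefect_eq_zero {ℓ δ g : ℝ} (hδ : 0 ≤ δ) (hδℓ : δ ≤ ℓ) (hg : δ ≤ g)
    (hg' : g ≤ π - ℓ + δ) (h : sinChordDefect ℓ δ g = 0) : g - δ = 0 ∨ g - δ = π - ℓ := by
  by_contra! hne
  have hlt : δ < g := hg.lt_of_ne fun heq => hne.1 (by linarith)
  have hlt' : g < π - ℓ + δ := hg'.lt_of_ne fun heq => hne.2 (by linarith)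
  exact (sinChordDefect_pos hδ hδℓ hlt hlt').ne' h

/-! ### Integrals over a triangle -/

/-- The part of the square `(a, b] × (a, b]` on or above the diagonal. -/
def triangle (a b : ℝ) : Set (ℝ × ℝ) := {p | (p.1 ∈ Ioc a b ∧ p.2 ∈ Ioc a b) ∧ p.1 ≤ p.2}

theorem measurableSet_triangle (a b : ℝ) : MeasurableSet (triangle a b) :=
  ((measurable_fst measurableSet_Ioc).inter (measurable_snd measurableSet_Ioc)).inter
    (measurableSet_le measurable_fst measurable_snd)

theorem setIntegral_triangle {a b : ℝ} (hab : a ≤ b) {g : ℝ × ℝ → ℝ}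
    (hg : IntegrableOn g (triangle a b)) :
    ∫ p in triangle a b, g p = ∫ θ in a..b, ∫ t in a..θ, g (t, θ) := by
  rw [← integrable_indicator_iff (measurableSet_triangle a b), Measure.volume_eq_prod] at hg
  rw [← integral_indicator (measurableSet_triangle a b), Measure.volume_eq_prod,
    integral_prod_symm _ hg, intervalIntegral.integral_of_le hab,
    ← integral_indicator measurableSet_Ioc]
  congr 1 with θ
  by_cases hθ : θ ∈ Ioc a b
  · rw [indicator_of_mem hθ, intervalIntegral.integral_of_le hθ.1.le,
      ← integral_indicator measurableSet_Ioc]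
    congr 1 with t
    refine indicator_eq_indicator ⟨fun h => ⟨h.1.1.1, h.2⟩, fun h => ?_⟩ rfl
    exact ⟨⟨⟨h.1, h.2.trans hθ.2⟩, hθ⟩, h.2⟩
  · rw [indicator_of_notMem hθ]
    exact integral_eq_zero_of_ae
      (Eventually.of_forall fun t => indicator_of_notMem (fun h => hθ h.1.2) _)

theorem setIntegral_triangle_swap {a b : ℝ} (hab : a ≤ b) {g : ℝ × ℝ → ℝ}
    (hg : IntegrableOn g (triangle a b)) :
    ∫ p in triangle a b, g p = ∫ t in a..b, ∫ θ in t..b, g (t, θ) := by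
  rw [← integrable_indicator_iff (measurableSet_triangle a b), Measure.volume_eq_prod] at hg
  rw [← integral_indicator (measurableSet_triangle a b), Measure.volume_eq_prod,
    integral_prod _ hg, intervalIntegral.integral_of_le hab, ← integral_indicator measurableSet_Ioc]
  congr 1 with t
  by_cases ht : t ∈ Ioc a b
  · rw [indicator_of_mem ht, intervalIntegral.integral_of_le ht.2, ← integral_Icc_eq_integral_Ioc,
      ← integral_indicator measurableSet_Icc]
    congr 1 with θ
    refine indicator_eq_indicator ⟨fun h => ⟨h.2, h.1.2.2⟩, fun h => ?_⟩ rfl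
    exact ⟨⟨ht, ht.1.trans_le h.1, h.2⟩, h.1⟩
  · rw [indicator_of_notMem ht]
    exact integral_eq_zero_of_ae
      (Eventually.of_forall fun θ => indicator_of_notMem (fun h => ht h.1.1) _)

/-! ### The integral inequality for densities on a half turn -/

/-- `S` is a primitive of a measurable density `ρ` with values in `[0, 1]`. -/
structure IsUnitPrimitive (ρ S : ℝ → ℝ) : Prop where
  measurable : Measurable ρ
  nonneg : ∀ x, 0 ≤ ρ x
  le_one : ∀ x, ρ x ≤ 1
  sub_eq : ∀ s t, S t - S s = ∫ x in s..t, ρ x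

/-- Twice the area between the chord and the arc of the convex curve with radius of curvature `ρ`,
over the normal angles in `[a, b]`. -/
noncomputable def twiceSegmentArea (ρ : ℝ → ℝ) (a b : ℝ) : ℝ :=
  ∫ θ in a..b, (∫ t in a..θ, sin (θ - t) * ρ t) * ρ θ

namespace IsUnitPrimitive

variable {ρ S : ℝ → ℝ}

theorem intervalIntegrable (h : IsUnitPrimitive ρ S) (a b : ℝ) :
    IntervalIntegrable ρ volume a b :=
  intervalIntegrable_of_bounded h.measurable
    (fun x => (abs_of_nonneg (h.nonneg x)).trans_le (h.le_one x)) a b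

theorem monotone (h : IsUnitPrimitive ρ S) : Monotone S := fun s t hst => sub_nonneg.1 <| by
  rw [h.sub_eq]
  exact intervalIntegral.integral_nonneg hst fun x _ => h.nonneg x

theorem sub_le (h : IsUnitPrimitive ρ S) {s t : ℝ} (hst : s ≤ t) : S t - S s ≤ t - s := by
  rw [h.sub_eq]
  simpa using intervalIntegral.integral_mono_on hst (h.intervalIntegrable s t)
    (intervalIntegrable_const (c := (1 : ℝ))) fun x _ => h.le_one x

theorem lipschitzWith (h : IsUnitPrimitive ρ S) : LipschitzWith 1 S :=
  LipschitzWith.of_dist_le_mul fun s t => by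
    rw [NNReal.coe_one, one_mul]
    wlog hst : s ≤ t generalizing s t
    · rw [dist_comm, dist_comm s]
      exact this t s (le_of_not_ge hst)
    rw [dist_comm, dist_comm s, dist_eq, dist_eq, abs_of_nonneg (sub_nonneg.2 (h.monotone hst)),
      abs_of_nonneg (sub_nonneg.2 hst)]
    exact h.sub_le hst

theorem continuous (h : IsUnitPrimitive ρ S) : Continuous S := h.lipschitzWith.continuous

theorem ae_hasDerivAt (h : IsUnitPrimitive ρ S) : ∀ᵐ x, HasDerivAt S (ρ x) x := by
  have hloc : LocallyIntegrable ρ volume := by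
    refine (locallyIntegrable_const (1 : ℝ)).mono h.measurable.aestronglyMeasurable
      (Eventually.of_forall fun x => ?_)
    rw [norm_of_nonneg (h.nonneg x), norm_one]
    exact h.le_one x
  filter_upwards [LocallyIntegrable.ae_hasDerivAt_integral hloc] with x hx
  refine ((hx 0).add_const (S 0)).congr_of_eventuallyEq (Eventually.of_forall fun y => ?_)
  simp only [← h.sub_eq, sub_add_cancel]

theorem integral_comp_mul (h : IsUnitPrimitive ρ S) {F f : ℝ → ℝ}
    (hF : ∀ x, HasDerivAt F (f x) x) {C : ℝ} (hC : ∀ x, |f x| ≤ C) (s t : ℝ) :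
    ∫ x in s..t, f (S x) * ρ x = F (S t) - F (S s) := by
  have hlip : LipschitzWith C.toNNReal F := lipschitzWith_of_nnnorm_deriv_le
    (fun x => (hF x).differentiableAt) fun x => by
      rw [(hF x).deriv]
      exact NNReal.le_toNNReal_of_coe_le (hC x)
  rw [← Function.comp_apply (f := F) (x := t), ← Function.comp_apply (f := F) (x := s),
    ← ((hlip.comp h.lipschitzWith).lipschitzOnWith
      (s := uIcc s t)).absolutelyContinuousOnInterval.integral_deriv_eq_sub]
  apply intervalIntegral.integral_congr_ae
  filter_upwards [h.ae_hasDerivAt] with x hx _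
  exact ((hF (S x)).comp x hx).deriv.symm

theorem integrableOn_triangle (h : IsUnitPrimitive ρ S) {g : ℝ × ℝ → ℝ} (hg : Continuous g)
    (a b : ℝ) : IntegrableOn (fun p => g p * (ρ p.1 * ρ p.2)) (triangle a b) := by
  have hg' : IntegrableOn g (triangle a b) :=
    (hg.continuousOn.integrableOn_compact (isCompact_Icc.prod isCompact_Icc)).mono_set
      fun p hp => ⟨Ioc_subset_Icc_self hp.1.1, Ioc_subset_Icc_self hp.1.2⟩
  refine Integrable.mul_bdd (c := 1) hg' ?_ (Eventually.of_forall fun p => ?_)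
  · exact ((h.measurable.comp measurable_fst).mul
      (h.measurable.comp measurable_snd)).aestronglyMeasurable
  · rw [norm_of_nonneg (mul_nonneg (h.nonneg _) (h.nonneg _))]
    exact mul_le_one₀ (h.le_one _) (h.nonneg _) (h.le_one _)

theorem setIntegral_triangle_sin_sub (h : IsUnitPrimitive ρ S) {a b : ℝ} (hab : a ≤ b) :
    ∫ p in triangle a b, sin (S p.2 - S p.1) * (ρ p.1 * ρ p.2) =
      (S b - S a) - sin (S b - S a) := by
  have hS := h.continuous
  have hinner (θ : ℝ) : ∫ t in a..θ, sin (S θ - S t) * ρ t = 1 - cos (S θ - S a) := by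
    rw [h.integral_comp_mul (F := fun x => cos (S θ - x)) (f := fun x => sin (S θ - x))
      (fun x => by simpa using ((hasDerivAt_id x).const_sub (S θ)).cos)
      (fun x => abs_sin_le_one _), sub_self, cos_zero]
  have hbound (x : ℝ) : |1 - cos x| ≤ 2 := by
    rw [abs_le]
    constructor <;> linarith [neg_one_le_cos x, cos_le_one x]
  calc ∫ p in triangle a b, sin (S p.2 - S p.1) * (ρ p.1 * ρ p.2)
      = ∫ θ in a..b, (1 - cos (S θ - S a)) * ρ θ := by
        rw [setIntegral_triangle hab (h.integrableOn_triangle (by fun_prop) a b)]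
        simp only [← mul_assoc, intervalIntegral.integral_mul_const, hinner]
    _ = (S b - S a) - sin (S b - S a) := by
        rw [h.integral_comp_mul (F := fun x => x - sin (x - S a)) (f := fun x => 1 - cos (x - S a))
          (fun x => by simpa using! (hasDerivAt_id x).sub ((hasDerivAt_id x).sub_const (S a)).sin)
          (fun x => hbound _), sub_self, sin_zero]
        ring

/-- Integrating `u p.2` first over `p.1`, and `u p.1` first over `p.2`, gives the same single
integral because `Φ` is symmetric. -/
theorem setIntegral_triangle_sub_mul_eq_zero (h : IsUnitPrimitive ρ S) {a b : ℝ} (hab : a ≤ b)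
    {u Φ Ψ : ℝ → ℝ} (hu : Continuous u) (hΨ : Continuous Ψ) (hΦ : ∀ δ, HasDerivAt Φ (Ψ δ) δ)
    {C : ℝ} (hC : ∀ δ, |Ψ δ| ≤ C) (hΦ0 : Φ 0 = 0) (hsymm : ∀ δ, Φ (S b - S a - δ) = Φ δ) :
    ∫ p in triangle a b, (u p.2 - u p.1) * Ψ (S p.2 - S p.1) * (ρ p.1 * ρ p.2) = 0 := by
  have hS := h.continuous
  have hfst (θ : ℝ) : ∫ t in a..θ, Ψ (S θ - S t) * ρ t = Φ (S θ - S a) := by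
    rw [h.integral_comp_mul (F := fun x => -Φ (S θ - x)) (f := fun x => Ψ (S θ - x))
      (fun x => by simpa using! ((hΦ (S θ - x)).comp x ((hasDerivAt_id x).const_sub (S θ))).neg)
      (fun x => hC _), sub_self, hΦ0]
    ring
  have hsnd (t : ℝ) : ∫ θ in t..b, Ψ (S θ - S t) * ρ θ = Φ (S t - S a) := by
    rw [h.integral_comp_mul (F := fun x => Φ (x - S t)) (f := fun x => Ψ (x - S t))
      (fun x => by simpa using! (hΦ (x - S t)).comp x ((hasDerivAt_id x).sub_const (S t)))
      (fun x => hC _), sub_self, hΦ0, sub_zero, ← hsymm]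
    congr 1
    ring
  have hint₁ := h.integrableOn_triangle (g := fun p => u p.1 * Ψ (S p.2 - S p.1)) (by fun_prop) a b
  have hint₂ := h.integrableOn_triangle (g := fun p => u p.2 * Ψ (S p.2 - S p.1)) (by fun_prop) a b
  simp only [sub_mul]
  rw [integral_sub hint₂ hint₁, setIntegral_triangle hab hint₂,
    setIntegral_triangle_swap hab hint₁, sub_eq_zero]
  refine intervalIntegral.integral_congr fun θ _ => ?_
  calc ∫ t in a..θ, u θ * Ψ (S θ - S t) * (ρ t * ρ θ)
      = ∫ t in a..θ, u θ * ρ θ * (Ψ (S θ - S t) * ρ t) := by congr 1 with t; ring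
    _ = u θ * ρ θ * Φ (S θ - S a) := by rw [intervalIntegral.integral_const_mul, hfst]
    _ = ∫ φ in θ..b, u θ * ρ θ * (Ψ (S φ - S θ) * ρ φ) := by
        rw [intervalIntegral.integral_const_mul, hsnd]
    _ = ∫ φ in θ..b, u θ * Ψ (S φ - S θ) * (ρ θ * ρ φ) := by congr 1 with φ; ring

theorem setIntegral_triangle_chord_eq_zero (h : IsUnitPrimitive ρ S) {a b : ℝ} (hab : a ≤ b) :
    ∫ p in triangle a b, ((p.2 - S p.2) - (p.1 - S p.1)) *
      (sin (S b - S a - (S p.2 - S p.1)) - sin (S p.2 - S p.1)) * (ρ p.1 * ρ p.2) = 0 := by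
  have hS := h.continuous
  set ℓ := S b - S a
  refine h.setIntegral_triangle_sub_mul_eq_zero hab (u := fun x => x - S x)
    (Φ := fun δ => cos (ℓ - δ) + cos δ - cos ℓ - 1) (Ψ := fun δ => sin (ℓ - δ) - sin δ) (C := 2)
    (by fun_prop) (by fun_prop) (fun δ => ?_) (fun δ => ?_) (by simp) (fun δ => ?_)
  · refine (((((hasDerivAt_id δ).const_sub ℓ).cos.add (hasDerivAt_cos δ)).sub_const
      (cos ℓ)).sub_const 1).congr_deriv ?_
    simp only [id_eq]
    ring
  · rw [abs_le]
    constructor <;> linarith [neg_one_le_sin δ, sin_le_one δ, neg_one_le_sin (ℓ - δ),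
      sin_le_one (ℓ - δ)]
  · rw [sub_sub_cancel, add_comm (cos δ)]

theorem continuous_sinChordDefect (h : IsUnitPrimitive ρ S) (ℓ : ℝ) :
    Continuous fun p : ℝ × ℝ => sinChordDefect ℓ (S p.2 - S p.1) (p.2 - p.1) := by
  have := h.continuous
  unfold sinChordDefect
  fun_prop

theorem setIntegral_sinChordDefect (h : IsUnitPrimitive ρ S) {a b : ℝ} (hab : a ≤ b) :
    ∫ p in triangle a b,
        sinChordDefect (S b - S a) (S p.2 - S p.1) (p.2 - p.1) * (ρ p.1 * ρ p.2) =
      twiceSegmentArea ρ a b - ((S b - S a) - sin (S b - S a)) := by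
  have hS := h.continuous
  set ℓ := S b - S a
  have hint₁ := h.integrableOn_triangle (g := fun p => sin (p.2 - p.1)) (by fun_prop) a b
  have hint₂ := h.integrableOn_triangle (g := fun p => sin (S p.2 - S p.1)) (by fun_prop) a b
  have hint₃ := h.integrableOn_triangle (g := fun p => ((p.2 - S p.2) - (p.1 - S p.1)) *
    (sin (ℓ - (S p.2 - S p.1)) - sin (S p.2 - S p.1))) (by fun_prop) a b
  have hsplit (p : ℝ × ℝ) :
      sinChordDefect ℓ (S p.2 - S p.1) (p.2 - p.1) * (ρ p.1 * ρ p.2) =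
        sin (p.2 - p.1) * (ρ p.1 * ρ p.2) - sin (S p.2 - S p.1) * (ρ p.1 * ρ p.2) -
        (π - ℓ)⁻¹ * (((p.2 - S p.2) - (p.1 - S p.1)) *
          (sin (ℓ - (S p.2 - S p.1)) - sin (S p.2 - S p.1)) * (ρ p.1 * ρ p.2)) := by
    rw [sinChordDefect]
    ring
  have hint₁₂ : IntegrableOn (fun p : ℝ × ℝ => sin (p.2 - p.1) * (ρ p.1 * ρ p.2) -
    sin (S p.2 - S p.1) * (ρ p.1 * ρ p.2)) (triangle a b) := hint₁.sub hint₂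
  simp only [hsplit]
  rw [integral_sub hint₁₂ (hint₃.const_mul _), integral_sub hint₁ hint₂,
    integral_const_mul, h.setIntegral_triangle_chord_eq_zero hab, mul_zero, sub_zero,
    h.setIntegral_triangle_sin_sub hab, setIntegral_triangle hab hint₁]
  simp only [twiceSegmentArea, ← mul_assoc, intervalIntegral.integral_mul_const, ℓ]

theorem chord_bounds (h : IsUnitPrimitive ρ S) {a b : ℝ} {p : ℝ × ℝ} (hp : p ∈ triangle a b) :
    0 ≤ S p.2 - S p.1 ∧ S p.2 - S p.1 ≤ S b - S a ∧ S p.2 - S p.1 ≤ p.2 - p.1 ∧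
      p.2 - p.1 ≤ (b - a) - (S b - S a) + (S p.2 - S p.1) := by
  obtain ⟨⟨⟨ha1, -⟩, ⟨-, h2b⟩⟩, h12⟩ := hp
  have := h.sub_le ha1.le
  have := h.sub_le h2b
  have := h.monotone ha1.le
  have := h.monotone h2b
  exact ⟨sub_nonneg.2 (h.monotone h12), by linarith, h.sub_le h12, by linarith⟩

theorem sinChordDefect_mul_nonneg (h : IsUnitPrimitive ρ S) {a : ℝ} {p : ℝ × ℝ}
    (hp : p ∈ triangle a (a + π)) :
    0 ≤ sinChordDefect (S (a + π) - S a) (S p.2 - S p.1) (p.2 - p.1) * (ρ p.1 * ρ p.2) := by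
  obtain ⟨h0, hℓ, hle, hge⟩ := h.chord_bounds hp
  rw [add_sub_cancel_left] at hge
  exact mul_nonneg (sinChordDefect_nonneg h0 hℓ hle hge) (mul_nonneg (h.nonneg _) (h.nonneg _))

theorem sub_sin_le_twiceSegmentArea (h : IsUnitPrimitive ρ S) (a : ℝ) :
    (S (a + π) - S a) - sin (S (a + π) - S a) ≤ twiceSegmentArea ρ a (a + π) := by
  rw [← sub_nonneg, ← h.setIntegral_sinChordDefect (le_add_of_nonneg_right pi_pos.le)]
  exact setIntegral_nonneg (measurableSet_triangle _ _) fun p hp => h.sinChordDefect_mul_nonneg hp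

theorem ae_gap_of_eq (h : IsUnitPrimitive ρ S) {a : ℝ}
    (heq : twiceSegmentArea ρ a (a + π) = (S (a + π) - S a) - sin (S (a + π) - S a)) :
    ∀ᵐ p : ℝ × ℝ, p ∈ triangle a (a + π) → ρ p.1 * ρ p.2 = 0 ∨
      (p.2 - p.1) - (S p.2 - S p.1) = 0 ∨
      (p.2 - p.1) - (S p.2 - S p.1) = π - (S (a + π) - S a) := by
  have hzero := h.setIntegral_sinChordDefect (le_add_of_nonneg_right pi_pos.le : a ≤ a + π)
  rw [heq, sub_self, setIntegral_eq_zero_iff_of_nonneg_ae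
    ((ae_restrict_iff' (measurableSet_triangle _ _)).2
      (Eventually.of_forall fun p hp => h.sinChordDefect_mul_nonneg hp))
    (h.integrableOn_triangle (h.continuous_sinChordDefect _) _ _)] at hzero
  filter_upwards [(ae_restrict_iff' (measurableSet_triangle _ _)).1 hzero] with p hp hpt
  obtain ⟨h0, hℓ, hle, hge⟩ := h.chord_bounds hpt
  rw [add_sub_cancel_left] at hge
  rcases mul_eq_zero.1 (hp hpt) with hdefect | hρ
  · exact Or.inr (eq_or_eq_of_sinChordDefect_eq_zero h0 hℓ hle hge hdefect)
  · exact Or.inl hρ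

end IsUnitPrimitive

/-! ### Area -/

/-- The standard area form of the plane. -/
def wedge (x y : Plane) : ℝ := x 0 * y 1 - x 1 * y 0

theorem wedge_smul_tangentVec (x : Plane) (r θ : ℝ) :
    wedge x (r • tangentVec θ) = ⟪x, unitVec θ⟫ * r := by
  simp [wedge, inner_plane]
  ring

/-- The linear map of the plane whose matrix has columns `x` and `y`. -/
noncomputable def columnMap (x y : Plane) : Plane →L[ℝ] Plane :=
  (EuclideanSpace.proj (0 : Fin 2) : Plane →L[ℝ] ℝ).smulRight x +
    (EuclideanSpace.proj (1 : Fin 2) : Plane →L[ℝ] ℝ).smulRight y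

theorem det_columnMap (x y : Plane) : (columnMap x y).det = wedge x y := by
  rw [ContinuousLinearMap.det,
    ← LinearMap.det_toMatrix (EuclideanSpace.basisFun (Fin 2) ℝ).toBasis, Matrix.det_fin_two]
  simp [LinearMap.toMatrix_apply, columnMap, wedge]
  ring

theorem measurePreserving_plane_coordinates :
    MeasurePreserving (fun w : Plane => (w 0, w 1)) volume volume :=
  (volume_preserving_finTwoArrow ℝ).comp
    (EuclideanSpace.volume_preserving_symm_measurableEquiv_toLp (Fin 2))

/-- The parametrization of the cone with apex `p` over the curve `X`: the first coordinate is the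
position on the segment from `p` to the point of `X` whose parameter is the second coordinate. -/
noncomputable def coneMap (p : Plane) (X : ℝ → Plane) (w : Plane) : Plane :=
  p + w 0 • (X (w 1) - p)

/-- The domain of `coneMap` for the part of the curve with parameters in `G`. The apex is left out
to keep the cone map injective. -/
def coneDomain (G : Set ℝ) : Set Plane := {w | w 0 ∈ Ioc 0 1 ∧ w 1 ∈ G}

theorem measurableSet_coneDomain {G : Set ℝ} (hG : MeasurableSet G) :
    MeasurableSet (coneDomain G) :=
  measurePreserving_plane_coordinates.measurable (measurableSet_Ioc.prod hG)

theorem hasFDerivAt_coneMap {p : Plane} {X : ℝ → Plane} {X' w : Plane}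
    (hX : HasDerivAt X X' (w 1)) :
    HasFDerivAt (coneMap p X) (columnMap (X (w 1) - p) (w 0 • X')) w := by
  have hproj (i : Fin 2) :
      HasFDerivAt (fun w : Plane => w i) (EuclideanSpace.proj i : Plane →L[ℝ] ℝ) w :=
    (EuclideanSpace.proj i : Plane →L[ℝ] ℝ).hasFDerivAt
  have hcurve : HasFDerivAt (fun w : Plane => X (w 1) - p)
      ((EuclideanSpace.proj (1 : Fin 2) : Plane →L[ℝ] ℝ).smulRight X') w :=
    (hX.hasFDerivAt.comp w (hproj 1) |>.congr_fderiv (by ext v; simp)).sub_const p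
  refine (((hproj 0).smul hcurve).const_add p).congr_fderiv ?_
  ext v
  simp [columnMap]
  ring

theorem volume_image_coneMap_ray_eq_zero (p : Plane) (X : ℝ → Plane) (θ : ℝ) :
    volume (coneMap p X '' {w | w 1 = θ}) = 0 := by
  refine addHaar_image_eq_zero_of_differentiableOn_of_addHaar_eq_zero volume ?_ ?_
  · have hray : DifferentiableOn ℝ (fun w : Plane => p + w 0 • (X θ - p)) {w | w 1 = θ} := by
      fun_prop
    exact hray.congr fun w hw => by rw [coneMap, show w 1 = θ from hw]
  · have hpre : {w : Plane | w 1 = θ} = (fun w : Plane => (w 0, w 1)) ⁻¹' (univ ×ˢ {θ}) := by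
      ext w
      simp
    rw [hpre, measurePreserving_plane_coordinates.measure_preimage
      (MeasurableSet.univ.prod (measurableSet_singleton θ)).nullMeasurableSet,
      Measure.volume_eq_prod, Measure.prod_prod, volume_singleton, mul_zero]

theorem lintegral_coneDomain {G : Set ℝ} (hG : MeasurableSet G) {g : ℝ → ℝ} (hg : Measurable g)
    (hg0 : ∀ θ, 0 ≤ g θ) :
    ∫⁻ w in coneDomain G, ENNReal.ofReal |w 0 * g (w 1)| =
      ENNReal.ofReal (1 / 2) * ∫⁻ θ in G, ENNReal.ofReal (g θ) := by
  have hsplit : ∀ᵐ q : ℝ × ℝ ∂((volume.restrict (Ioc (0 : ℝ) 1)).prod (volume.restrict G)),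
      ENNReal.ofReal |q.1 * g q.2| = ENNReal.ofReal q.1 * ENNReal.ofReal (g q.2) := by
    rw [Measure.prod_restrict]
    refine (ae_restrict_iff' (measurableSet_Ioc.prod hG)).2 (Eventually.of_forall fun q hq => ?_)
    have hq0 : 0 ≤ q.1 := hq.1.1.le
    rw [abs_of_nonneg (mul_nonneg hq0 (hg0 _)), ENNReal.ofReal_mul hq0]
  have hhalf : ∫⁻ t in Ioc (0 : ℝ) 1, ENNReal.ofReal t = ENNReal.ofReal (1 / 2) := by
    rw [← ofReal_integral_eq_lintegral_ofReal, ← intervalIntegral.integral_of_le zero_le_one,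
      integral_id]
    · norm_num
    · exact (continuous_id.integrableOn_Icc (a := (0 : ℝ)) (b := 1)).mono_set Ioc_subset_Icc_self
    · exact (ae_restrict_iff' measurableSet_Ioc).2 (Eventually.of_forall fun t ht => ht.1.le)
  have hf : Measurable fun q : ℝ × ℝ => ENNReal.ofReal |q.1 * g q.2| := by fun_prop
  calc ∫⁻ w in coneDomain G, ENNReal.ofReal |w 0 * g (w 1)|
      = ∫⁻ q in Ioc (0 : ℝ) 1 ×ˢ G, ENNReal.ofReal |q.1 * g q.2| :=
        measurePreserving_plane_coordinates.setLIntegral_comp_preimage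
          (measurableSet_Ioc.prod hG) hf
    _ = (∫⁻ t in Ioc (0 : ℝ) 1, ENNReal.ofReal t) * ∫⁻ θ in G, ENNReal.ofReal (g θ) := by
        rw [Measure.volume_eq_prod, ← Measure.prod_restrict, lintegral_congr_ae hsplit,
          lintegral_prod_mul (f := fun t : ℝ => ENNReal.ofReal t)
            (g := fun θ : ℝ => ENNReal.ofReal (g θ)) (by fun_prop) (by fun_prop)]
    _ = ENNReal.ofReal (1 / 2) * ∫⁻ θ in G, ENNReal.ofReal (g θ) := by rw [hhalf]

/-- The parameters in the period `[a, a + 2 * π)` at which the curve `X` is differentiable with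
positive radius of curvature. -/
def regularAngles (X : ℝ → Plane) (a : ℝ) : Set ℝ :=
  {θ | θ ∈ Ico a (a + 2 * π) ∧ DifferentiableAt ℝ X θ ∧ 0 < curvRadius X θ}

theorem measurableSet_regularAngles (X : ℝ → Plane) (a : ℝ) :
    MeasurableSet (regularAngles X a) :=
  measurableSet_Ico.inter ((measurableSet_of_differentiableAt ℝ X).inter
    (measurableSet_lt measurable_const (measurable_curvRadius X)))

theorem curvRadius_eq_zero_of_notMem_regularAngles {K : Set Plane} {X : ℝ → Plane}
    (hX : IsSupportCurve K X) {a θ : ℝ} (hθ : θ ∈ Ico a (a + 2 * π))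
    (hreg : θ ∉ regularAngles X a) : curvRadius X θ = 0 := by
  by_cases hdiff : DifferentiableAt ℝ X θ
  · exact (not_lt.1 fun hpos => hreg ⟨hθ, hdiff, hpos⟩).antisymm (hX.curvRadius_nonneg θ)
  · rw [curvRadius, deriv_zero_of_not_differentiableAt hdiff, inner_zero_left]

theorem not_forall_eq_of_curvRadius_pos {X : ℝ → Plane} {θ b : ℝ} (hθb : θ < b)
    (hdiff : DifferentiableAt ℝ X θ) (hpos : 0 < curvRadius X θ) :
    ¬ ∀ t ∈ Icc θ b, X t = X θ := by
  intro hconst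
  have hderiv : deriv X θ = 0 :=
    (uniqueDiffOn_Icc hθb θ ⟨le_rfl, hθb.le⟩).eq_deriv _ hdiff.hasDerivAt.hasDerivWithinAt
      ((hasDerivWithinAt_const θ _ (X θ)).congr hconst rfl)
  rw [curvRadius, hderiv, inner_zero_left] at hpos
  exact hpos.false

theorem exists_mem_frontier_eq_add_smul {E : Type*} [NormedAddCommGroup E] [NormedSpace ℝ E]
    {K : Set E} (hK : IsCompact K) {p y : E} (hy : y ∈ K) (hyp : y ≠ p) :
    ∃ t ∈ Ioc (0 : ℝ) 1, ∃ z ∈ frontier K, y = p + t • (z - p) := by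
  set f : ℝ → E := fun s => p + s • (y - p) with hf
  have hfc : Continuous f := by fun_prop
  have hpos : 0 < ‖y - p‖ := norm_pos_iff.2 (sub_ne_zero.2 hyp)
  obtain ⟨M, hM⟩ := hK.isBounded.subset_closedBall p
  have hbdd : f ⁻¹' K ⊆ Icc (-(M / ‖y - p‖)) (M / ‖y - p‖) := fun s hs => by
    have hball := mem_closedBall_iff_norm.1 (hM hs)
    rw [hf, add_sub_cancel_left, norm_smul, norm_eq_abs] at hball
    exact abs_le.1 ((le_div_iff₀ hpos).2 hball)
  have hcompact : IsCompact (f ⁻¹' K) :=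
    isCompact_Icc.of_isClosed_subset (hK.isClosed.preimage hfc) hbdd
  have hone : (1 : ℝ) ∈ f ⁻¹' K := by simp [hf, hy]
  obtain ⟨s, hs, hsmax⟩ := hcompact.exists_isGreatest ⟨1, hone⟩
  have hfrontier : f s ∈ frontier K := by
    refine ⟨subset_closure hs, fun hinterior => ?_⟩
    have hnear : ∀ᶠ x in 𝓝[>] s, f x ∈ K := ((hfc.tendsto s).mono_left
      nhdsWithin_le_nhds).eventually (mem_interior_iff_mem_nhds.1 hinterior)
    obtain ⟨x, hxK, hsx⟩ := (hnear.and self_mem_nhdsWithin).exists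
    exact absurd (hsmax hxK) (not_le.2 hsx)
  have hs0 : 0 < s := one_pos.trans_le (hsmax hone)
  refine ⟨s⁻¹, ⟨by positivity, inv_le_one_of_one_le₀ (hsmax hone)⟩, f s, hfrontier, ?_⟩
  rw [hf, add_sub_cancel_left, smul_smul, inv_mul_cancel₀ hs0.ne', one_smul, add_sub_cancel]

namespace IsRollingCurve

variable {R : ℝ} {K : Set Plane} {X : ℝ → Plane}

theorem eq_of_eq_of_mem_regularAngles (hX : IsRollingCurve R K X) (hint : (interior K).Nonempty)
    {a s t : ℝ} (hs : s ∈ regularAngles X a) (ht : t ∈ regularAngles X a) (heq : X s = X t) :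
    s = t := by
  wlog hst : s ≤ t generalizing s t
  · exact (this ht hs heq.symm (le_of_not_ge hst)).symm
  by_contra hne
  have hlt : s < t := hst.lt_of_ne hne
  rcases lt_trichotomy t (s + π) with h | h | h
  · exact not_forall_eq_of_curvRadius_pos hlt hs.2.1 hs.2.2 fun x hx => hX.eq_of_eq h heq hx
  · exact hX.ne_add_pi hint s (h ▸ heq)
  · refine not_forall_eq_of_curvRadius_pos (b := s + 2 * π) (by linarith [ht.1.2, hs.1.1])
      ht.2.1 ht.2.2 fun x hx => hX.eq_of_eq (by linarith) ?_ hx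
    rw [hX.periodic, heq]

/-- Otherwise `X φ` would lie strictly between `X θ` and the interior point `p`. -/
theorem add_smul_ne_add_smul (hX : IsRollingCurve R K X) (hconv : Convex ℝ K) {p : Plane}
    (hp : p ∈ interior K) {s t : ℝ} (hs : 0 < s) (hst : s < t) (θ φ : ℝ) :
    p + s • (X θ - p) ≠ p + t • (X φ - p) := by
  intro heq
  have ht : 0 < t := hs.trans hst
  have hradial : X φ - p = (s / t) • (X θ - p) := by
    rw [div_eq_inv_mul, mul_smul, add_left_cancel heq, smul_smul, inv_mul_cancel₀ ht.ne', one_smul]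
  have hcombo : X φ = (1 - s / t) • p + (s / t) • X θ := by
    rw [← sub_add_cancel (X φ) p, hradial]
    module
  refine (hX.mem_frontier φ).2 (hcombo ▸ ?_)
  exact hconv.combo_interior_self_mem_interior hp (hX.mem θ) (sub_pos.2 ((div_lt_one ht).2 hst))
    (by positivity) (by ring)

theorem injOn_coneMap (hX : IsRollingCurve R K X) (hconv : Convex ℝ K) {p : Plane}
    (hp : p ∈ interior K) (a : ℝ) : InjOn (coneMap p X) (coneDomain (regularAngles X a)) := by
  intro w hw z hz hwz
  have hradius : w 0 = z 0 := by
    rcases lt_trichotomy (w 0) (z 0) with h | h | h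
    · exact absurd hwz (hX.add_smul_ne_add_smul hconv hp hw.1.1 h _ _)
    · exact h
    · exact absurd hwz.symm (hX.add_smul_ne_add_smul hconv hp hz.1.1 h _ _)
  have hcurve : w 0 • (X (w 1) - p) = z 0 • (X (z 1) - p) := add_left_cancel hwz
  rw [← hradius] at hcurve
  exact plane_ext hradius (hX.eq_of_eq_of_mem_regularAngles ⟨p, hp⟩ hw.2 hz.2
    (sub_left_injective (smul_right_injective _ hw.1.1.ne' hcurve)))

theorem intervalIntegrable_density (hX : IsRollingCurve R K X) (p : Plane) (a b : ℝ) :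
    IntervalIntegrable (fun θ => ⟪X θ - p, unitVec θ⟫ * curvRadius X θ) volume a b := by
  have := hX.continuous
  simpa only [mul_comm] using hX.intervalIntegrable_curvRadius_mul
    (g := fun θ => ⟪X θ - p, unitVec θ⟫) (by fun_prop) a b

theorem lintegral_abs_det_cone (hX : IsRollingCurve R K X) {p : Plane} (hp : p ∈ K) {G : Set ℝ}
    (hG : MeasurableSet G) :
    ∫⁻ w in coneDomain G,
        ENNReal.ofReal |(columnMap (X (w 1) - p) (w 0 • deriv X (w 1))).det| =
      ENNReal.ofReal (1 / 2) *
        ∫⁻ θ in G, ENNReal.ofReal (⟪X θ - p, unitVec θ⟫ * curvRadius X θ) := by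
  have hdet (w : Plane) : (columnMap (X (w 1) - p) (w 0 • deriv X (w 1))).det =
      w 0 * (⟪X (w 1) - p, unitVec (w 1)⟫ * curvRadius X (w 1)) := by
    rw [det_columnMap, hX.deriv_eq, smul_smul, wedge_smul_tangentVec]
    ring
  have hcont : Continuous fun θ => ⟪X θ - p, unitVec θ⟫ := by
    have := hX.continuous
    fun_prop
  simp only [hdet]
  exact lintegral_coneDomain hG (hcont.measurable.mul (measurable_curvRadius X)) fun θ =>
    mul_nonneg (hX.inner_sub_nonneg hp θ) (hX.curvRadius_nonneg θ)

theorem lintegral_density (hX : IsRollingCurve R K X) {p : Plane} (hp : p ∈ K) (a : ℝ) :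
    ENNReal.ofReal (1 / 2) * ∫⁻ θ in Ico a (a + 2 * π),
      ENNReal.ofReal (⟪X θ - p, unitVec θ⟫ * curvRadius X θ) =
    ENNReal.ofReal (1 / 2 * ∫ θ in a..a + 2 * π, ⟪X θ - p, unitVec θ⟫ * curvRadius X θ) := by
  have hle : a ≤ a + 2 * π := by linarith [pi_pos]
  rw [ENNReal.ofReal_mul (by norm_num), intervalIntegral.integral_of_le hle,
    restrict_Ico_eq_restrict_Ioc, ofReal_integral_eq_lintegral_ofReal]
  · exact (intervalIntegrable_iff_integrableOn_Ioc_of_le hle).1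
      (hX.intervalIntegrable_density p _ _)
  · exact Eventually.of_forall fun θ =>
      mul_nonneg (hX.inner_sub_nonneg hp θ) (hX.curvRadius_nonneg θ)

theorem integral_le_volume (hX : IsRollingCurve R K X) (hconv : Convex ℝ K) {p : Plane}
    (hp : p ∈ interior K) (a : ℝ) :
    ENNReal.ofReal (1 / 2 * ∫ θ in a..a + 2 * π, ⟪X θ - p, unitVec θ⟫ * curvRadius X θ) ≤
      volume K := by
  have hpK := interior_subset hp
  have hG := measurableSet_regularAngles X a
  have hderiv : ∀ w ∈ coneDomain (regularAngles X a), HasFDerivWithinAt (coneMap p X)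
      (columnMap (X (w 1) - p) (w 0 • deriv X (w 1))) (coneDomain (regularAngles X a)) w :=
    fun w hw => (hasFDerivAt_coneMap hw.2.2.1.hasDerivAt).hasFDerivWithinAt
  have hcone : coneMap p X '' coneDomain (regularAngles X a) ⊆ K := by
    rintro _ ⟨w, hw, rfl⟩
    exact hconv.add_smul_sub_mem hpK (hX.mem _) ⟨hw.1.1.le, hw.1.2⟩
  have hregular : ∫⁻ θ in Ico a (a + 2 * π),
        ENNReal.ofReal (⟪X θ - p, unitVec θ⟫ * curvRadius X θ) ≤
      ∫⁻ θ in regularAngles X a, ENNReal.ofReal (⟪X θ - p, unitVec θ⟫ * curvRadius X θ) := by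
    rw [← lintegral_indicator hG, ← lintegral_indicator measurableSet_Ico]
    refine lintegral_mono (indicator_le fun θ hθ => ?_)
    by_cases hreg : θ ∈ regularAngles X a
    · rw [indicator_of_mem hreg]
    · rw [curvRadius_eq_zero_of_notMem_regularAngles hX.toIsSupportCurve hθ hreg, mul_zero,
        ENNReal.ofReal_zero]
      exact zero_le
  calc _ = ENNReal.ofReal (1 / 2) * ∫⁻ θ in Ico a (a + 2 * π),
        ENNReal.ofReal (⟪X θ - p, unitVec θ⟫ * curvRadius X θ) := (hX.lintegral_density hpK a).symm
    _ ≤ ENNReal.ofReal (1 / 2) * ∫⁻ θ in regularAngles X a,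
        ENNReal.ofReal (⟪X θ - p, unitVec θ⟫ * curvRadius X θ) := by gcongr
    _ = volume (coneMap p X '' coneDomain (regularAngles X a)) := by
        rw [← hX.lintegral_abs_det_cone hpK hG, lintegral_abs_det_fderiv_eq_addHaar_image volume
          (measurableSet_coneDomain hG) hderiv (hX.injOn_coneMap hconv hp a)]
    _ ≤ volume K := measure_mono hcone

theorem exists_eq_add_smul (hX : IsRollingCurve R K X) (hK : IsCompact K) (hconv : Convex ℝ K)
    (hint : (interior K).Nonempty) {p y : Plane} (hy : y ∈ K) (hyp : y ≠ p) (a : ℝ) :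
    ∃ t ∈ Ioc (0 : ℝ) 1, ∃ θ ∈ Ico a (a + 2 * π), y = p + t • (X θ - p) := by
  obtain ⟨t, ht, z, hz, hyz⟩ := exists_mem_frontier_eq_add_smul hK hy hyp
  rw [hX.frontier_eq hK.isClosed hconv hint a] at hz
  obtain ⟨θ, hθ, rfl⟩ := hz
  exact ⟨t, ht, θ, hθ, hyz⟩

theorem volume_le_integral (hX : IsRollingCurve R K X) (hK : IsCompact K) (hconv : Convex ℝ K)
    (hint : (interior K).Nonempty) {p : Plane} (hp : p ∈ K) (a : ℝ) {C : Set ℝ}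
    (hC : C.Countable) (hdiff : ∀ θ ∈ Ico a (a + 2 * π) \ C, DifferentiableAt ℝ X θ) :
    volume K ≤
      ENNReal.ofReal (1 / 2 * ∫ θ in a..a + 2 * π, ⟪X θ - p, unitVec θ⟫ * curvRadius X θ) := by
  set G : Set ℝ := Ico a (a + 2 * π) \ C
  have hG : MeasurableSet G := measurableSet_Ico.diff hC.measurableSet
  have hderiv : ∀ w ∈ coneDomain G, HasFDerivWithinAt (coneMap p X)
      (columnMap (X (w 1) - p) (w 0 • deriv X (w 1))) (coneDomain G) w := fun w hw =>
    (hasFDerivAt_coneMap (hdiff _ hw.2).hasDerivAt).hasFDerivWithinAt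
  set N := {p} ∪ ⋃ θ ∈ C, coneMap p X '' {w : Plane | w 1 = θ}
  have hN : volume N = 0 := measure_union_null (measure_singleton p)
    ((measure_biUnion_null_iff hC).2 fun θ _ => volume_image_coneMap_ray_eq_zero p X θ)
  have hcover : K ⊆ N ∪ coneMap p X '' coneDomain G := by
    intro y hy
    by_cases hyp : y = p
    · exact Or.inl (Or.inl hyp)
    obtain ⟨t, ht, θ, hθ, hyt⟩ := hX.exists_eq_add_smul hK hconv hint hy hyp a
    have hcone : coneMap p X !₂[t, θ] = y := by simp [hyt, coneMap]
    by_cases hθC : θ ∈ C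
    · exact Or.inl (Or.inr (mem_iUnion₂.2 ⟨θ, hθC, !₂[t, θ], by simp, hcone⟩))
    · exact Or.inr ⟨!₂[t, θ], ⟨by simpa using ht, by simpa using ⟨hθ, hθC⟩⟩, hcone⟩
  calc volume K ≤ volume N + volume (coneMap p X '' coneDomain G) :=
        (measure_mono hcover).trans (measure_union_le _ _)
    _ = volume (coneMap p X '' coneDomain G) := by rw [hN, zero_add]
    _ ≤ ENNReal.ofReal (1 / 2) *
          ∫⁻ θ in G, ENNReal.ofReal (⟪X θ - p, unitVec θ⟫ * curvRadius X θ) := by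
        rw [← hX.lintegral_abs_det_cone hp hG]
        exact addHaar_image_le_lintegral_abs_det_fderiv volume (measurableSet_coneDomain hG) hderiv
    _ ≤ _ := by
        rw [← hX.lintegral_density hp a]
        gcongr
        exact sdiff_subset

end IsRollingCurve

/-! ### Equality in the integral inequality -/

namespace IsUnitPrimitive

variable {ρ S : ℝ → ℝ}

theorem half_mem_Icc (h : IsUnitPrimitive ρ S) (a : ℝ) : S (a + π) - S a ∈ Icc 0 π := by
  have hle : a ≤ a + π := by linarith [pi_pos]
  exact ⟨sub_nonneg.2 (h.monotone hle), (h.sub_le hle).trans_eq (add_sub_cancel_left a π)⟩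

theorem monotone_id_sub (h : IsUnitPrimitive ρ S) : Monotone fun θ => θ - S θ := fun x y hxy => by
  have := h.sub_le hxy
  linarith

theorem ae_density_sub_eq (h : IsUnitPrimitive ρ S) {c m : ℝ}
    (hshift : ∀ x, S (x + c) - S x = m) : ∀ᵐ x, ρ (x - c) = ρ x := by
  have hshifted : ∀ᵐ x, HasDerivAt S (ρ (x - c)) (x - c) :=
    (measurePreserving_sub_right volume c).quasiMeasurePreserving.ae h.ae_hasDerivAt
  have hS : (fun y => S (y - c) + m) = S := by
    funext y
    rw [← hshift (y - c), sub_add_cancel, add_sub_cancel]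
  filter_upwards [h.ae_hasDerivAt, hshifted] with x hx hxc
  have hderiv : HasDerivAt (fun y => S (y - c) + m) (ρ (x - c)) x := by
    simpa using (hxc.comp x ((hasDerivAt_id x).sub_const c)).add_const m
  rw [hS] at hderiv
  exact hderiv.unique hx

theorem exists_density_ne_zero_of_ae_prod (h : IsUnitPrimitive ρ S) {a b : ℝ} (hab : a ≤ b)
    (hlt : S a < S b) {P : ℝ × ℝ → Prop} (hP : ∀ᵐ p, P p) :
    ∃ t ∈ Ioc a b, ρ t ≠ 0 ∧ (∀ᵐ θ, P (t, θ)) ∧ ∀ᵐ θ, P (θ, t) := by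
  rw [Measure.volume_eq_prod] at hP
  have hswap : ∀ᵐ p : ℝ × ℝ ∂(volume.prod volume), P p.swap :=
    Measure.measurePreserving_swap.quasiMeasurePreserving.ae hP
  by_contra hcon
  have hzero : ∫ x in a..b, ρ x = ∫ _x in a..b, (0 : ℝ) := by
    apply intervalIntegral.integral_congr_ae
    filter_upwards [Measure.ae_ae_of_ae_prod hP, Measure.ae_ae_of_ae_prod hswap] with x hx hx' hxab
    rw [uIoc_of_le hab] at hxab
    by_contra hρ
    exact hcon ⟨x, hxab, hρ, hx, hx'⟩
  rw [← h.sub_eq, intervalIntegral.integral_zero] at hzero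
  linarith

/-- Since `θ - S θ` is continuous and monotone, it must pass all intermediate values where `ρ`
vanishes, so there it grows with unit speed. -/
theorem exists_eq_of_ae_gap (h : IsUnitPrimitive ρ S) {s t g : ℝ} (hst : s ≤ t) (hg : 0 < g)
    (ht : t - S t = s - S s + g)
    (hae : ∀ᵐ θ, θ ∈ Ioc s t → ρ θ = 0 ∨ θ - S θ = s - S s ∨ θ - S θ = s - S s + g) :
    ∃ α, S (α + g) = S α := by
  have hmono := h.monotone_id_sub
  have hcont : Continuous fun θ => θ - S θ := continuous_id.sub h.continuous
  obtain ⟨α, ⟨hα, hαle⟩, hαmax⟩ := (isCompact_Icc.inter_right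
    (isClosed_le hcont continuous_const)).exists_isGreatest
    (⟨s, ⟨le_rfl, hst⟩, le_refl (s - S s)⟩ : (Icc s t ∩ {x | x - S x ≤ s - S s}).Nonempty)
  obtain ⟨β, ⟨hβ, hβge⟩, hβmin⟩ := (isCompact_Icc.inter_right
    (isClosed_le continuous_const hcont)).exists_isLeast
    (⟨t, ⟨hst, le_rfl⟩, ht.ge⟩ : (Icc s t ∩ {x | s - S s + g ≤ x - S x}).Nonempty)
  have hzα : α - S α = s - S s := le_antisymm hαle (hmono hα.1)
  have hzβ : β - S β = s - S s + g := le_antisymm ((hmono hβ.2).trans_eq ht) hβge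
  have hαβ : α ≤ β := le_of_not_ge fun hle => by
    have : β - S β ≤ α - S α := hmono hle
    linarith
  have hzero : ∫ x in α..β, ρ x = ∫ _x in α..β, (0 : ℝ) := by
    apply intervalIntegral.integral_congr_ae
    filter_upwards [hae, ae_iff.2 (by simp : volume {x | ¬ x ≠ β} = 0)] with x hx hxβ hxm
    rw [uIoc_of_le hαβ] at hxm
    have hxI : x ∈ Icc s t := ⟨hα.1.trans hxm.1.le, hxm.2.trans hβ.2⟩
    rcases hx ⟨hα.1.trans_lt hxm.1, hxI.2⟩ with h0 | hlow | hhigh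
    · exact h0
    · exact absurd (hαmax ⟨hxI, hlow.le⟩) (not_le.2 hxm.1)
    · exact absurd (hβmin ⟨hxI, hhigh.ge⟩) (not_le.2 (hxm.2.lt_of_ne hxβ))
  rw [← h.sub_eq, intervalIntegral.integral_zero] at hzero
  refine ⟨α, ?_⟩
  rw [show α + g = β by linarith]
  linarith

theorem exists_eq_of_twiceSegmentArea_eq (h : IsUnitPrimitive ρ S) {m : ℝ} (hm0 : 0 < m)
    (hmπ : m < π) (hhalf : ∀ a, S (a + π) - S a = m) {a : ℝ}
    (heq : twiceSegmentArea ρ a (a + π) = m - sin m) : ∃ α, S (α + (π - m)) = S α := by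
  have hpair := h.ae_gap_of_eq (a := a) (by rwa [hhalf])
  simp only [hhalf] at hpair
  obtain ⟨t, ht, hρt, hright, hleft⟩ := h.exists_density_ne_zero_of_ae_prod
    (by linarith [pi_pos] : a ≤ a + π) (by linarith [hhalf a]) hpair
  have hleft' : ∀ᵐ θ, (θ - π, t) ∈ triangle a (a + π) → ρ (θ - π) * ρ t = 0 ∨
      (t - (θ - π)) - (S t - S (θ - π)) = 0 ∨ (t - (θ - π)) - (S t - S (θ - π)) = π - m :=
    (measurePreserving_sub_right volume π).quasiMeasurePreserving.ae hleft
  refine h.exists_eq_of_ae_gap (s := t) (t := t + π) (by linarith [pi_pos]) (sub_pos.2 hmπ)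
    (by linarith [hhalf t]) ?_
  filter_upwards [hright, hleft', h.ae_density_sub_eq hhalf] with θ hr hl hper hθ
  rcases le_or_gt θ (a + π) with hle | hgt
  · rcases hr ⟨⟨ht, ht.1.trans hθ.1, hle⟩, hθ.1.le⟩ with h0 | h0 | h0
    · exact Or.inl ((mul_eq_zero.1 h0).resolve_left hρt)
    · exact Or.inr (Or.inl (by linarith))
    · exact Or.inr (Or.inr (by linarith))
  · have hshift : S θ - S (θ - π) = m := by rw [← hhalf (θ - π), sub_add_cancel]
    have hmem : (θ - π, t) ∈ triangle a (a + π) :=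
      ⟨⟨⟨by linarith, by linarith [hθ.2, ht.2]⟩, ht⟩, by linarith [hθ.2]⟩
    rcases hl hmem with h0 | h0 | h0
    · exact Or.inl (hper ▸ (mul_eq_zero.1 h0).resolve_right hρt)
    · exact Or.inr (Or.inr (by linarith))
    · exact Or.inr (Or.inl (by linarith))

end IsUnitPrimitive

/-! ### Two half turns -/

theorem strictConvexOn_sub_sin_Icc : StrictConvexOn ℝ (Icc 0 π) fun x => x - sin x :=
  (convexOn_id (convex_Icc 0 π)).sub_strictConcaveOn strictConcaveOn_sin_Icc

namespace IsUnitPrimitive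

variable {ρ S : ℝ → ℝ}

theorem two_mul_sub_sin_le (h : IsUnitPrimitive ρ S) {a m : ℝ}
    (hm : S (a + π + π) - S a = 2 * m) :
    2 * (m - sin m) ≤
      twiceSegmentArea ρ a (a + π) + twiceSegmentArea ρ (a + π) (a + π + π) := by
  have hconv := strictConvexOn_sub_sin_Icc.convexOn.2 (h.half_mem_Icc a) (h.half_mem_Icc (a + π))
    one_half_pos.le one_half_pos.le (add_halves 1)
  simp only [smul_eq_mul] at hconv
  rw [show 1 / 2 * (S (a + π) - S a) + 1 / 2 * (S (a + π + π) - S (a + π)) = m by linarith]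
    at hconv
  linarith [h.sub_sin_le_twiceSegmentArea a, h.sub_sin_le_twiceSegmentArea (a + π)]

theorem eq_of_twiceSegmentArea_add_le (h : IsUnitPrimitive ρ S) {a m : ℝ}
    (hm : S (a + π + π) - S a = 2 * m)
    (hle : twiceSegmentArea ρ a (a + π) + twiceSegmentArea ρ (a + π) (a + π + π) ≤
      2 * (m - sin m)) :
    S (a + π) - S a = m ∧ twiceSegmentArea ρ a (a + π) = m - sin m := by
  have h₁ := h.sub_sin_le_twiceSegmentArea a
  have h₂ := h.sub_sin_le_twiceSegmentArea (a + π)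
  have hhalves : S (a + π) - S a = S (a + π + π) - S (a + π) := by
    by_contra hne
    have hconv := strictConvexOn_sub_sin_Icc.2 (h.half_mem_Icc a) (h.half_mem_Icc (a + π)) hne
      one_half_pos one_half_pos (add_halves 1)
    simp only [smul_eq_mul] at hconv
    rw [show 1 / 2 * (S (a + π) - S a) + 1 / 2 * (S (a + π + π) - S (a + π)) = m by linarith]
      at hconv
    linarith
  have hfst : S (a + π) - S a = m := by linarith
  rw [← hhalves, hfst] at h₂
  rw [hfst] at h₁
  exact ⟨hfst, by linarith⟩

end IsUnitPrimitive

/-! ### Bodies with a rolling curve -/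

/-- The primitive of the normalized radius of curvature `curvRadius X / R`. -/
noncomputable def turnLength (R : ℝ) (X : ℝ → Plane) (θ : ℝ) : ℝ :=
  ∫ t in 0..θ, curvRadius X t / R

theorem inner_le_of_mem_closedBall {R θ : ℝ} {c x y : Plane} (hc : x - R • unitVec θ = c)
    (hy : y ∈ Metric.closedBall c R) : ⟪y, unitVec θ⟫ ≤ ⟪x, unitVec θ⟫ := by
  have hinner : ⟪y - c, unitVec θ⟫ ≤ R := by
    refine (real_inner_le_norm _ _).trans ?_
    rw [norm_unitVec, mul_one]
    exact mem_closedBall_iff_norm.1 hy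
  rw [← hc, inner_sub_left, inner_sub_left, real_inner_smul_left, inner_unitVec_unitVec, sub_self,
    cos_zero] at hinner
  linarith

theorem inner_unitVec_le_of_mem_Icc {a b θ : ℝ} {x y : Plane} (hab : a < b) (hb : b < a + π)
    (hθ : θ ∈ Icc a b) (hya : ⟪y, unitVec a⟫ ≤ ⟪x, unitVec a⟫)
    (hyb : ⟪y, unitVec b⟫ ≤ ⟪x, unitVec b⟫) : ⟪y, unitVec θ⟫ ≤ ⟪x, unitVec θ⟫ := by
  have hsin : 0 < sin (b - a) := sin_pos_of_pos_of_lt_pi (by linarith) (by linarith)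
  have hsinb : 0 ≤ sin (b - θ) :=
    sin_nonneg_of_nonneg_of_le_pi (by linarith [hθ.2]) (by linarith [hθ.1])
  have hsina : 0 ≤ sin (θ - a) :=
    sin_nonneg_of_nonneg_of_le_pi (by linarith [hθ.1]) (by linarith [hθ.2])
  refine le_of_mul_le_mul_left ?_ hsin
  rw [sin_mul_inner_unitVec, sin_mul_inner_unitVec x]
  gcongr

theorem IsSupportCurve.mem_of_forall_inner_le {K : Set Plane} {X : ℝ → Plane}
    (hX : IsSupportCurve K X) (hK : IsClosed K) (hconv : Convex ℝ K) {y : Plane} (a : ℝ)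
    (hy : ∀ θ ∈ Ico a (a + 2 * π), ⟪y, unitVec θ⟫ ≤ ⟪X θ, unitVec θ⟫) : y ∈ K := by
  by_contra hyK
  obtain ⟨f, r, hfK, hfy⟩ := geometric_hahn_banach_closed_point hconv hK hyK
  obtain ⟨θ, hθ, hw⟩ := exists_eq_norm_smul_unitVec ((InnerProductSpace.toDual ℝ Plane).symm f) a
  set w := (InnerProductSpace.toDual ℝ Plane).symm f
  have hf (x : Plane) : f x = ‖w‖ * ⟪x, unitVec θ⟫ := by
    rw [real_inner_comm, ← real_inner_smul_left, ← hw, InnerProductSpace.toDual_symm_apply]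
  have hle : f y ≤ f (X θ) := by
    rw [hf, hf]
    exact mul_le_mul_of_nonneg_left (hy θ hθ) (norm_nonneg w)
  linarith [hfK _ (hX.mem θ)]

namespace IsRollingCurve

variable {R : ℝ} {K : Set Plane} {X : ℝ → Plane}

theorem isUnitPrimitive (hX : IsRollingCurve R K X) :
    IsUnitPrimitive (fun θ => curvRadius X θ / R) (turnLength R X) where
  measurable := (measurable_curvRadius X).div_const R
  nonneg θ := div_nonneg (hX.curvRadius_nonneg θ) hX.pos.le
  le_one θ := (div_le_one hX.pos).2 (hX.curvRadius_le θ)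
  sub_eq _ _ := intervalIntegral.integral_interval_sub_left
    ((hX.intervalIntegrable_curvRadius _ _).div_const R)
    ((hX.intervalIntegrable_curvRadius _ _).div_const R)

theorem integral_curvRadius (hX : IsRollingCurve R K X) (a b : ℝ) :
    ∫ t in a..b, curvRadius X t = R * (turnLength R X b - turnLength R X a) := by
  rw [hX.isUnitPrimitive.sub_eq, intervalIntegral.integral_div,
    mul_div_cancel₀ _ hX.pos.ne']

theorem integral_inner_unitVec (hX : IsRollingCurve R K X) (w : Plane) (a b : ℝ) :
    ∫ θ in a..b, ⟪w, unitVec θ⟫ * curvRadius X θ = wedge w (X b - X a) := by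
  have hwedge : wedge w (X b - X a) = ⟪X b - X a, !₂[-w 1, w 0]⟫ := by
    simp [wedge, inner_plane]
    ring
  rw [hwedge, hX.inner_sub_eq_integral]
  refine intervalIntegral.integral_congr fun θ _ => ?_
  simp [inner_plane]
  ring

theorem integral_density_eq (hX : IsRollingCurve R K X) (p : Plane) (a b : ℝ) :
    ∫ θ in a..b, ⟪X θ - p, unitVec θ⟫ * curvRadius X θ =
      R ^ 2 * twiceSegmentArea (fun θ => curvRadius X θ / R) a b +
        wedge (X a - p) (X b - X a) := by
  have hR := hX.pos.ne'
  have hsin (θ t : ℝ) : sin (θ - t) * (curvRadius X t / R) =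
      curvRadius X t * ⟪tangentVec t, unitVec θ⟫ / R := by
    rw [inner_tangentVec_unitVec]
    ring
  have hchord (θ : ℝ) : R ^ 2 * ((∫ t in a..θ, sin (θ - t) * (curvRadius X t / R)) *
      (curvRadius X θ / R)) = ⟪X θ - X a, unitVec θ⟫ * curvRadius X θ := by
    rw [hX.inner_sub_eq_integral]
    simp only [hsin, intervalIntegral.integral_div]
    field_simp
  rw [← hX.integral_inner_unitVec, twiceSegmentArea, ← intervalIntegral.integral_const_mul]
  simp only [hchord]
  rw [← intervalIntegral.integral_add (hX.intervalIntegrable_density _ _ _)]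
  · refine intervalIntegral.integral_congr fun θ _ => ?_
    simp only [inner_sub_left]
    ring
  · simpa only [mul_comm] using hX.intervalIntegrable_curvRadius_mul
      (g := fun θ => ⟪X a - p, unitVec θ⟫) (by fun_prop) a b

/-- The chord terms of the two opposite arcs cancel. -/
theorem integral_density_eq_halves (hX : IsRollingCurve R K X) (p : Plane) (a : ℝ) :
    ∫ θ in a..a + 2 * π, ⟪X θ - p, unitVec θ⟫ * curvRadius X θ =
      R ^ 2 * (twiceSegmentArea (fun θ => curvRadius X θ / R) a (a + π) +
        twiceSegmentArea (fun θ => curvRadius X θ / R) (a + π) (a + π + π)) := by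
  have hturn : a + 2 * π = a + π + π := by ring
  have hper : X (a + π + π) = X a := by rw [← hturn, hX.periodic]
  rw [hturn, ← intervalIntegral.integral_add_adjacent_intervals
    (hX.intervalIntegrable_density p a (a + π)) (hX.intervalIntegrable_density p _ _),
    hX.integral_density_eq p, hX.integral_density_eq p (a + π), hper]
  simp only [wedge, PiLp.sub_apply]
  ring

theorem eq_of_turnLength_eq (hX : IsRollingCurve R K X) {a b θ : ℝ}
    (h : turnLength R X b = turnLength R X a) (hθ : θ ∈ Icc a b) : X θ = X a := by
  have hle := hX.norm_sub_le_integral hθ.1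
  have hmono := hX.isUnitPrimitive.monotone hθ.2
  rw [hX.integral_curvRadius] at hle
  exact sub_eq_zero.1 (norm_le_zero_iff.1
    (hle.trans (mul_nonpos_of_nonneg_of_nonpos hX.pos.le (by linarith))))

theorem ae_curvRadius_eq (hX : IsRollingCurve R K X) {a b : ℝ} (hab : a ≤ b)
    (h : turnLength R X b - turnLength R X a = b - a) :
    ∀ᵐ t, t ∈ Ioc a b → curvRadius X t = R := by
  have hi := hX.intervalIntegrable_curvRadius a b
  have hzero : ∫ t in a..b, (R - curvRadius X t) = 0 := by
    rw [intervalIntegral.integral_sub intervalIntegrable_const hi, hX.integral_curvRadius, h,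
      intervalIntegral.integral_const, smul_eq_mul, mul_comm, sub_self]
  rw [intervalIntegral.integral_eq_zero_iff_of_le_of_nonneg_ae hab
    (Eventually.of_forall fun t => sub_nonneg.2 (hX.curvRadius_le t))
    (intervalIntegrable_const.sub hi)] at hzero
  filter_upwards [(ae_restrict_iff' measurableSet_Ioc).1 hzero] with t ht htab
  exact (sub_eq_zero.1 (ht htab)).symm

theorem center_eq_of_turnLength_sub_eq (hX : IsRollingCurve R K X) {a b : ℝ} (hab : a ≤ b)
    (h : turnLength R X b - turnLength R X a = b - a) :
    X b - R • unitVec b = X a - R • unitVec a := by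
  have hchord : X b - X a = R • (unitVec b - unitVec a) := ext_inner_right ℝ fun w => by
    calc ⟪X b - X a, w⟫ = ∫ t in a..b, curvRadius X t * ⟪tangentVec t, w⟫ :=
          hX.inner_sub_eq_integral w a b
      _ = ∫ t in a..b, R * ⟪w, tangentVec t⟫ := by
          apply intervalIntegral.integral_congr_ae
          filter_upwards [hX.ae_curvRadius_eq hab h] with t ht htab
          rw [uIoc_of_le hab] at htab
          rw [ht htab, real_inner_comm]
      _ = R * (⟪w, unitVec b⟫ - ⟪w, unitVec a⟫) := by
          rw [intervalIntegral.integral_const_mul,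
            intervalIntegral.integral_eq_sub_of_hasDerivAt (fun t _ => hasDerivAt_inner_unitVec w t)
            ((continuous_const.inner continuous_tangentVec).intervalIntegrable _ _)]
      _ = ⟪R • (unitVec b - unitVec a), w⟫ := by
          rw [real_inner_smul_left, inner_sub_left, real_inner_comm w, real_inner_comm w]
  rw [smul_sub] at hchord
  rw [sub_eq_sub_iff_sub_eq_sub, hchord]

/-- For normal angles in this half turn the boundary is an arc of the first circle followed by a
vertex, which the second disk already touches. -/
theorem inner_le_of_mem_lens (hX : IsRollingCurve R K X) {α g : ℝ} (hg0 : 0 < g) (hgπ : g < π)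
    (hhalf : ∀ a, turnLength R X (a + π) - turnLength R X a = π - g)
    (hgap : turnLength R X (α + g) = turnLength R X α) {y : Plane}
    (hy₁ : y ∈ Metric.closedBall (X α - R • unitVec α) R)
    (hy₂ : y ∈ Metric.closedBall (X (α + π) - R • unitVec (α + π)) R) {θ : ℝ}
    (hθ : θ ∈ Icc (α + g - π) (α + g)) : ⟪y, unitVec θ⟫ ≤ ⟪X θ, unitVec θ⟫ := by
  have hS := hX.isUnitPrimitive
  rcases le_total θ α with hθα | hαθ
  · have hfull : turnLength R X α - turnLength R X θ = α - θ := by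
      have := hhalf (α + g - π)
      rw [sub_add_cancel] at this
      linarith [hS.sub_le hθ.1, hS.sub_le hθα]
    exact inner_le_of_mem_closedBall (hX.center_eq_of_turnLength_sub_eq hθα hfull).symm hy₁
  · have hvertex : X (α + g) = X α :=
      hX.eq_of_turnLength_eq hgap (right_mem_Icc.2 (by linarith))
    have hcenter := hX.center_eq_of_turnLength_sub_eq (a := α + g) (b := α + π) (by linarith)
      (by linarith [hhalf α])
    rw [hX.eq_of_turnLength_eq hgap ⟨hαθ, hθ.2⟩]
    refine inner_unitVec_le_of_mem_Icc (a := α) (b := α + g) (by linarith) (by linarith)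
      ⟨hαθ, hθ.2⟩ (inner_le_of_mem_closedBall rfl hy₁) ?_
    rw [← hvertex]
    exact inner_le_of_mem_closedBall hcenter.symm hy₂

theorem center_ne_center (hX : IsRollingCurve R K X) {α g : ℝ} (hg0 : 0 < g) (hgπ : g < π)
    (hhalf : ∀ a, turnLength R X (a + π) - turnLength R X a = π - g)
    (hgap : turnLength R X (α + g) = turnLength R X α) :
    X α - R • unitVec α ≠ X (α + π) - R • unitVec (α + π) := by
  intro heq
  rw [hX.center_eq_of_turnLength_sub_eq (a := α + g) (b := α + π) (by linarith)
    (by linarith [hhalf α]), hX.eq_of_turnLength_eq hgap (right_mem_Icc.2 (by linarith)),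
    sub_right_inj] at heq
  have hunit : unitVec α = unitVec (α + g) := smul_right_injective _ hX.pos.ne' heq
  have hcos : cos g = 1 := by
    rw [← add_sub_cancel_left α g, ← inner_unitVec_unitVec, hunit, inner_unitVec_unitVec, sub_self,
      cos_zero]
  exact hg0.ne' ((cos_eq_one_iff_of_lt_of_lt (by linarith) (by linarith)).1 hcos)

theorem exists_lens_of_turnLength_eq (hX : IsRollingCurve R K X) (hK : IsClosed K)
    (hconv : Convex ℝ K) {α g : ℝ} (hg0 : 0 < g) (hgπ : g < π)
    (hhalf : ∀ a, turnLength R X (a + π) - turnLength R X a = π - g)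
    (hgap : turnLength R X (α + g) = turnLength R X α) :
    ∃ c₁ c₂ : Plane, c₁ ≠ c₂ ∧ K = Metric.closedBall c₁ R ∩ Metric.closedBall c₂ R := by
  refine ⟨_, _, hX.center_ne_center hg0 hgπ hhalf hgap, Subset.antisymm
    (subset_inter (hX.subset_closedBall α) (hX.subset_closedBall (α + π))) fun y hy => ?_⟩
  refine hX.mem_of_forall_inner_le hK hconv (α + g - π) fun θ hθ => ?_
  rcases le_total θ (α + g) with hle | hge
  · exact hX.inner_le_of_mem_lens hg0 hgπ hhalf hgap hy.1 hy.2 ⟨hθ.1, hle⟩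
  · have hgap' : turnLength R X (α + π + g) = turnLength R X (α + π) := by
      have := hhalf (α + g)
      rw [add_right_comm] at this
      linarith [hhalf α]
    have hturn : α + π + π = α + 2 * π := by ring
    exact hX.inner_le_of_mem_lens hg0 hgπ hhalf hgap' hy.2
      (by rw [hturn, hX.periodic, unitVec_add_two_pi]; exact hy.1)
      ⟨by linarith, by linarith [hθ.2]⟩

theorem sub_sin_le_volume (hX : IsRollingCurve R K X) (hconv : Convex ℝ K)
    (hint : (interior K).Nonempty) {m : ℝ}
    (hm : ∀ a, turnLength R X (a + 2 * π) - turnLength R X a = 2 * m) :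
    ENNReal.ofReal (R ^ 2 * (m - sin m)) ≤ volume K := by
  obtain ⟨p, hp⟩ := hint
  refine le_trans (ENNReal.ofReal_le_ofReal ?_) (hX.integral_le_volume hconv hp 0)
  have hhalves := hX.isUnitPrimitive.two_mul_sub_sin_le (a := 0) (m := m)
    (by rw [← hm 0, two_mul, add_assoc])
  rw [hX.integral_density_eq_halves, mul_left_comm]
  exact mul_le_mul_of_nonneg_left (by linarith) (sq_nonneg R)

theorem exists_lens_of_volume_eq (hX : IsRollingCurve R K X) (hK : IsClosed K)
    (hconv : Convex ℝ K) (hint : (interior K).Nonempty) {m : ℝ} (hm0 : 0 < m) (hmπ : m < π)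
    (hm : ∀ a, turnLength R X (a + 2 * π) - turnLength R X a = 2 * m)
    (hvol : volume K = ENNReal.ofReal (R ^ 2 * (m - sin m))) :
    ∃ c₁ c₂ : Plane, c₁ ≠ c₂ ∧ K = Metric.closedBall c₁ R ∩ Metric.closedBall c₂ R := by
  obtain ⟨p, hp⟩ := hint
  have hR2 : 0 < R ^ 2 := pow_pos hX.pos 2
  have hhalf (a : ℝ) : turnLength R X (a + π) - turnLength R X a = m ∧
      twiceSegmentArea (fun θ => curvRadius X θ / R) a (a + π) = m - sin m := by
    have hle := hX.integral_le_volume hconv hp a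
    rw [hvol, ENNReal.ofReal_le_ofReal_iff (mul_nonneg hR2.le (sub_nonneg.2 (sin_le hm0.le))),
      hX.integral_density_eq_halves, mul_left_comm] at hle
    have := le_of_mul_le_mul_left hle hR2
    exact hX.isUnitPrimitive.eq_of_twiceSegmentArea_add_le (by rw [← hm a, two_mul, add_assoc])
      (by linarith)
  obtain ⟨α, hα⟩ := hX.isUnitPrimitive.exists_eq_of_twiceSegmentArea_eq hm0 hmπ
    (fun a => (hhalf a).1) (hhalf 0).2
  exact hX.exists_lens_of_turnLength_eq hK hconv (sub_pos.2 hmπ) (sub_lt_self π hm0)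
    (fun a => (hhalf a).1.trans (sub_sub_cancel π m).symm) hα

end IsRollingCurve

/-! ### Lenses -/

theorem IsLambdaConvexLens.isLambdaConvexBody {lam : ℝ} {L : Set Plane}
    (hL : IsLambdaConvexLens lam L) : IsLambdaConvexBody lam L := by
  obtain ⟨c₁, c₂, -, rfl, hint⟩ := hL
  refine ⟨(isCompact_closedBall _ _).inter (isCompact_closedBall _ _),
    (convex_closedBall _ _).inter (convex_closedBall _ _), hint, fun p hp => ?_⟩
  have hsub := (Metric.isClosed_closedBall.inter Metric.isClosed_closedBall).frontier_subset
    (s := Metric.closedBall c₁ (1 / lam) ∩ Metric.closedBall c₂ (1 / lam))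
  rcases frontier_inter_subset _ _ hp with h | h
  · exact ⟨univ, univ_mem, c₁, Metric.frontier_closedBall_subset_sphere h.1,
      fun y hy => (hsub hy.2).1⟩
  · exact ⟨univ, univ_mem, c₂, Metric.frontier_closedBall_subset_sphere h.2,
      fun y hy => (hsub hy.2).2⟩

/-- The center of the disk of radius `R` bounding the lens `lens R φ q ω` in direction `ω`. -/
noncomputable def lensCenter (R φ : ℝ) (q : Plane) (ω : ℝ) : Plane :=
  q - (R * cos φ) • unitVec ω

/-- The lens with center of symmetry `q` bounded by two circular arcs of radius `R`, whose outer
normal angles are those within `φ` of `ω` and of `ω + π`, respectively. -/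
noncomputable def lens (R φ : ℝ) (q : Plane) (ω : ℝ) : Set Plane :=
  Metric.closedBall (lensCenter R φ q ω) R ∩ Metric.closedBall (lensCenter R φ q (ω + π)) R

theorem lensCenter_add_pi (R φ : ℝ) (q : Plane) (ω : ℝ) :
    lensCenter R φ q (ω + π) = q + (R * cos φ) • unitVec ω := by
  rw [lensCenter, unitVec_add_pi, smul_neg, sub_neg_eq_add]

theorem lens_add_pi (R φ : ℝ) (q : Plane) (ω : ℝ) : lens R φ q (ω + π) = lens R φ q ω := by
  have hcenter : lensCenter R φ q (ω + π + π) = lensCenter R φ q ω := by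
    rw [lensCenter, lensCenter, unitVec_add_pi, unitVec_add_pi, neg_neg]
  rw [lens, lens, hcenter, inter_comm]

theorem isCompact_lens (R φ : ℝ) (q : Plane) (ω : ℝ) : IsCompact (lens R φ q ω) :=
  (isCompact_closedBall _ _).inter (isCompact_closedBall _ _)

theorem convex_lens (R φ : ℝ) (q : Plane) (ω : ℝ) : Convex ℝ (lens R φ q ω) :=
  (convex_closedBall _ _).inter (convex_closedBall _ _)

theorem mem_interior_lens {R φ : ℝ} (hR : 0 < R) (hφ : φ ∈ Ioo 0 (π / 2)) (q : Plane) (ω : ℝ) :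
    q ∈ interior (lens R φ q ω) := by
  have hcos : 0 < cos φ := cos_pos_of_mem_Ioo ⟨by linarith [hφ.1, pi_pos], hφ.2⟩
  have hcos_lt : cos φ < 1 := by
    simpa using cos_lt_cos_of_nonneg_of_le_pi_div_two le_rfl hφ.2.le hφ.1
  have hball (θ : ℝ) : q ∈ Metric.ball (lensCenter R φ q θ) R := by
    rw [mem_ball_iff_norm, lensCenter, sub_sub_cancel, norm_smul, norm_unitVec, mul_one,
      norm_of_nonneg (by positivity)]
    exact mul_lt_of_lt_one_right hR hcos_lt
  rw [lens, interior_inter, interior_closedBall', interior_closedBall']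
  exact ⟨hball ω, hball (ω + π)⟩

theorem exists_eq_lens {R : ℝ} {c₁ c₂ : Plane} (hne : c₁ ≠ c₂)
    (hint : (interior (Metric.closedBall c₁ R ∩ Metric.closedBall c₂ R)).Nonempty) :
    ∃ φ ∈ Ioo 0 (π / 2), ∃ q ω, Metric.closedBall c₁ R ∩ Metric.closedBall c₂ R = lens R φ q ω := by
  rw [interior_inter, interior_closedBall', interior_closedBall'] at hint
  have hdist := Metric.dist_lt_add_of_nonempty_ball_inter_ball hint
  rw [dist_comm, dist_eq_norm] at hdist
  have hpos : 0 < ‖c₂ - c₁‖ := norm_pos_iff.2 (sub_ne_zero.2 hne.symm)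
  obtain ⟨ω, -, hω⟩ := exists_eq_norm_smul_unitVec (c₂ - c₁) 0
  set d := ‖c₂ - c₁‖ / 2 with hd
  have hR : 0 < R := by linarith
  have hdR : d / R < 1 := (div_lt_one hR).2 (by linarith)
  have hcos : R * cos (arccos (d / R)) = d := by
    rw [cos_arccos (by linarith [div_nonneg (half_pos hpos).le hR.le]) hdR.le]
    field_simp
  refine ⟨arccos (d / R), ⟨arccos_pos.2 hdR, arccos_lt_pi_div_two.2 (by positivity)⟩,
    midpoint ℝ c₁ c₂, ω, ?_⟩
  have hdω : d • unitVec ω = (1 / 2 : ℝ) • (c₂ - c₁) := by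
    rw [hd, div_eq_inv_mul, mul_smul, ← hω, one_div]
  rw [lens, lensCenter_add_pi, lensCenter, hcos, hdω, midpoint_eq_smul_add, invOf_eq_inv]
  congr 2 <;> module

theorem norm_unitVec_sub_smul_le_one {c θ ω : ℝ} (hc : 0 ≤ c) (hcos : c ≤ cos (θ - ω)) :
    ‖unitVec θ - (2 * c) • unitVec ω‖ ≤ 1 := by
  rw [← sq_le_one_iff₀ (norm_nonneg _), norm_sub_sq_real, norm_smul, norm_unitVec, norm_unitVec,
    real_inner_smul_right, inner_unitVec_unitVec, norm_of_nonneg (by positivity)]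
  nlinarith

/-- For normal angles in `[a, b]` the curve `X` runs along the circle of center `c` and radius `r`.
The radius `0` is allowed and describes a vertex. -/
def IsCircularArc (X : ℝ → Plane) (r : ℝ) (c : Plane) (a b : ℝ) : Prop :=
  ∀ θ ∈ Icc a b, X θ = c + r • unitVec θ

namespace IsCircularArc

variable {X : ℝ → Plane} {r a b θ : ℝ} {c : Plane}

theorem hasDerivAt (h : IsCircularArc X r c a b) (hθ : θ ∈ Ioo a b) :
    HasDerivAt X (r • tangentVec θ) θ :=
  (((hasDerivAt_unitVec θ).const_smul r).const_add c).congr_of_eventuallyEq <| by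
    filter_upwards [Ioo_mem_nhds hθ.1 hθ.2] with t ht
    exact h t (Ioo_subset_Icc_self ht)

theorem curvRadius_eq (h : IsCircularArc X r c a b) (hθ : θ ∈ Ioo a b) : curvRadius X θ = r := by
  rw [curvRadius, (h.hasDerivAt hθ).deriv, real_inner_smul_left, inner_tangentVec_tangentVec,
    sub_self, cos_zero, mul_one]

theorem integral_curvRadius (h : IsCircularArc X r c a b) (hab : a ≤ b) :
    ∫ θ in a..b, curvRadius X θ = r * (b - a) := by
  rw [intervalIntegral.integral_congr_Ioo_of_le hab fun θ hθ => h.curvRadius_eq hθ,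
    intervalIntegral.integral_const, smul_eq_mul, mul_comm]

theorem integral_density (h : IsCircularArc X r c a b) (hab : a ≤ b) (p : Plane) :
    ∫ θ in a..b, ⟪X θ - p, unitVec θ⟫ * curvRadius X θ =
      r * (⟪c - p, tangentVec a⟫ - ⟪c - p, tangentVec b⟫ + r * (b - a)) := by
  have hdensity : (Ioo a b).EqOn (fun θ => ⟪X θ - p, unitVec θ⟫ * curvRadius X θ)
      fun θ => r * (⟪c - p, unitVec θ⟫ + r) := fun θ hθ => by
    simp only [h.curvRadius_eq hθ, h θ (Ioo_subset_Icc_self hθ), add_sub_right_comm,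
      inner_add_left, real_inner_smul_left, inner_unitVec_unitVec, sub_self, cos_zero, mul_one,
      mul_comm]
  have hprimitive : ∀ θ ∈ uIcc a b, HasDerivAt (fun θ => r * θ - ⟪c - p, tangentVec θ⟫)
      (⟪c - p, unitVec θ⟫ + r) θ := fun θ _ => by
    refine (((hasDerivAt_id θ).const_mul r).sub
      ((hasDerivAt_const θ (c - p)).inner ℝ (hasDerivAt_tangentVec θ))).congr_deriv ?_
    simp only [inner_neg_right, inner_zero_left]
    ring
  rw [intervalIntegral.integral_congr_Ioo_of_le hab hdensity, intervalIntegral.integral_const_mul,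
    intervalIntegral.integral_eq_sub_of_hasDerivAt hprimitive
      (Continuous.intervalIntegrable (by fun_prop) _ _)]
  ring

end IsCircularArc

namespace IsRollingCurve

variable {R φ ω : ℝ} {q : Plane} {X : ℝ → Plane}

theorem isCircularArc_lens (hX : IsRollingCurve R (lens R φ q ω) X) (hφ : φ ∈ Ioo 0 (π / 2)) :
    IsCircularArc X R (lensCenter R φ q ω) (ω - φ) (ω + φ) := by
  intro θ hθ
  have hcosφ : 0 ≤ cos φ := (cos_pos_of_mem_Ioo ⟨by linarith [hφ.1, pi_pos], hφ.2⟩).le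
  have hcos : cos φ ≤ cos (θ - ω) := by
    rw [← cos_abs (θ - ω)]
    exact cos_le_cos_of_nonneg_of_le_pi (abs_nonneg _) (by linarith [hφ.2, pi_pos])
      (abs_le.2 ⟨by linarith [hθ.1], by linarith [hθ.2]⟩)
  have hmem : lensCenter R φ q ω + R • unitVec θ ∈ lens R φ q ω := by
    constructor
    · rw [mem_closedBall_iff_norm, add_sub_cancel_left, norm_smul, norm_unitVec, mul_one,
        norm_of_nonneg hX.pos.le]
    · have hdiff : lensCenter R φ q ω + R • unitVec θ - lensCenter R φ q (ω + π) =
          R • (unitVec θ - (2 * cos φ) • unitVec ω) := by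
        rw [lensCenter_add_pi, lensCenter]
        module
      rw [mem_closedBall_iff_norm, hdiff, norm_smul, norm_of_nonneg hX.pos.le]
      exact mul_le_of_le_one_right hX.pos.le (norm_unitVec_sub_smul_le_one hcosφ hcos)
  exact (hX.eq_of_inner_eq θ hmem (le_antisymm (hX.inner_le θ _ hmem)
    (inner_le_of_mem_closedBall (add_sub_cancel_right _ _) (hX.mem θ).1))).symm

theorem isCircularArc_lens_vertex (hX : IsRollingCurve R (lens R φ q ω) X)
    (hφ : φ ∈ Ioo 0 (π / 2)) :
    IsCircularArc X 0 (q + (R * sin φ) • tangentVec ω) (ω + φ) (ω + π - φ) := by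
  have hfst : X (ω + φ) = q + (R * sin φ) • tangentVec ω := by
    rw [hX.isCircularArc_lens hφ _ ⟨by linarith [hφ.1], le_rfl⟩, lensCenter, unitVec_add]
    module
  have hsnd : X (ω + π - φ) = q + (R * sin φ) • tangentVec ω := by
    rw [← lens_add_pi] at hX
    rw [hX.isCircularArc_lens hφ _ ⟨le_rfl, by linarith [hφ.1]⟩, lensCenter_add_pi,
      add_sub_assoc, unitVec_add, cos_pi_sub, sin_pi_sub]
    module
  intro θ hθ
  rw [hX.eq_of_eq (by linarith [hφ.1]) (hfst.trans hsnd.symm) hθ, hfst, zero_smul, add_zero]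

theorem integral_curvRadius_lens (hX : IsRollingCurve R (lens R φ q ω) X)
    (hφ : φ ∈ Ioo 0 (π / 2)) :
    ∫ θ in ω - φ..ω + π - φ, curvRadius X θ = 2 * R * φ := by
  rw [← intervalIntegral.integral_add_adjacent_intervals
      (hX.intervalIntegrable_curvRadius _ (ω + φ)) (hX.intervalIntegrable_curvRadius _ _),
    (hX.isCircularArc_lens hφ).integral_curvRadius (by linarith [hφ.1]),
    (hX.isCircularArc_lens_vertex hφ).integral_curvRadius (by linarith [hφ.2])]
  ring

theorem integral_density_lens (hX : IsRollingCurve R (lens R φ q ω) X)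
    (hφ : φ ∈ Ioo 0 (π / 2)) :
    ∫ θ in ω - φ..ω + π - φ, ⟪X θ - q, unitVec θ⟫ * curvRadius X θ =
      R ^ 2 * (2 * φ - sin (2 * φ)) := by
  rw [← intervalIntegral.integral_add_adjacent_intervals
      (hX.intervalIntegrable_density q _ (ω + φ)) (hX.intervalIntegrable_density q _ _),
    (hX.isCircularArc_lens hφ).integral_density (by linarith [hφ.1]),
    (hX.isCircularArc_lens_vertex hφ).integral_density (by linarith [hφ.2]), lensCenter,
    sub_sub_cancel_left]
  simp only [inner_neg_left, real_inner_smul_left, inner_unitVec_tangentVec, sub_sub_cancel,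
    sub_add_cancel_left, sin_neg, sin_two_mul]
  ring

theorem differentiableAt_lens (hX : IsRollingCurve R (lens R φ q ω) X) (hφ : φ ∈ Ioo 0 (π / 2))
    {θ : ℝ} (hθ : θ ∈ Ico (ω - φ) (ω + π - φ)) (h₁ : θ ≠ ω - φ) (h₂ : θ ≠ ω + φ) :
    DifferentiableAt ℝ X θ := by
  rcases h₂.lt_or_gt with h | h
  · exact ((hX.isCircularArc_lens hφ).hasDerivAt ⟨hθ.1.lt_of_ne' h₁, h⟩).differentiableAt
  · exact ((hX.isCircularArc_lens_vertex hφ).hasDerivAt ⟨h, hθ.2⟩).differentiableAt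

theorem perimeter_lens (hX : IsRollingCurve R (lens R φ q ω) X) (hφ : φ ∈ Ioo 0 (π / 2)) :
    perimeter (lens R φ q ω) = ENNReal.ofReal (2 * R * (2 * φ)) := by
  have hX' : IsRollingCurve R (lens R φ q (ω + π)) X := by rwa [lens_add_pi]
  rw [hX.perimeter_eq (isCompact_lens ..).isClosed (convex_lens ..)
      ⟨q, mem_interior_lens hX.pos hφ q ω⟩ (ω - φ),
    show ω - φ + 2 * π = ω + π + π - φ by ring,
    ← intervalIntegral.integral_add_adjacent_intervals
      (hX.intervalIntegrable_curvRadius _ (ω + π - φ)) (hX.intervalIntegrable_curvRadius _ _),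
    hX.integral_curvRadius_lens hφ, hX'.integral_curvRadius_lens hφ]
  congr 1
  ring

theorem volume_lens_le (hX : IsRollingCurve R (lens R φ q ω) X) (hφ : φ ∈ Ioo 0 (π / 2)) :
    volume (lens R φ q ω) ≤ ENNReal.ofReal (R ^ 2 * (2 * φ - sin (2 * φ))) := by
  have hX' : IsRollingCurve R (lens R φ q (ω + π)) X := by rwa [lens_add_pi]
  have hq := mem_interior_lens hX.pos hφ q ω
  have hturn : ω - φ + 2 * π = ω + π + π - φ := by ring
  have hdiff : ∀ θ ∈ Ico (ω - φ) (ω - φ + 2 * π) \ {ω - φ, ω + φ, ω + π - φ, ω + π + φ},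
      DifferentiableAt ℝ X θ := by
    rintro θ ⟨hθ, hθC⟩
    simp only [mem_insert_iff, mem_singleton_iff, not_or] at hθC
    rcases lt_or_ge θ (ω + π - φ) with h | h
    · exact hX.differentiableAt_lens hφ ⟨hθ.1, h⟩ hθC.1 hθC.2.1
    · exact hX'.differentiableAt_lens hφ ⟨h, hθ.2.trans_eq hturn⟩ hθC.2.2.1 hθC.2.2.2
  refine (hX.volume_le_integral (isCompact_lens ..) (convex_lens ..) ⟨q, hq⟩
    (interior_subset hq) (ω - φ) (toFinite _).countable hdiff).trans_eq ?_
  rw [hturn, ← intervalIntegral.integral_add_adjacent_intervals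
      (hX.intervalIntegrable_density q _ (ω + π - φ)) (hX.intervalIntegrable_density q _ _),
    hX.integral_density_lens hφ, hX'.integral_density_lens hφ]
  congr 1
  ring

end IsRollingCurve

theorem IsLambdaConvexLens.exists_perimeter_volume {lam : ℝ} (hlam : 0 < lam) {L : Set Plane}
    (hL : IsLambdaConvexLens lam L) :
    ∃ m ∈ Ioo 0 π, perimeter L = ENNReal.ofReal (2 * (1 / lam) * m) ∧
      volume L ≤ ENNReal.ofReal ((1 / lam) ^ 2 * (m - sin m)) := by
  obtain ⟨X, hX⟩ := hL.isLambdaConvexBody.exists_isRollingCurve hlam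
  obtain ⟨c₁, c₂, hne, hL_eq, hint⟩ := hL
  obtain ⟨φ, hφ, q, ω, hlens⟩ := exists_eq_lens hne (hL_eq ▸ hint)
  rw [hL_eq, hlens] at hX ⊢
  exact ⟨2 * φ, ⟨by linarith [hφ.1], by linarith [hφ.2]⟩, hX.perimeter_lens hφ,
    hX.volume_lens_le hφ⟩

/-! ### The reverse isoperimetric inequality -/

theorem IsRollingCurve.turnLength_sub_eq_of_perimeter_eq {R m : ℝ} {K : Set Plane} {X : ℝ → Plane}
    (hX : IsRollingCurve R K X) (hK : IsClosed K) (hconv : Convex ℝ K)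
    (hint : (interior K).Nonempty) (hm : 0 ≤ m) (hper : perimeter K = ENNReal.ofReal (2 * R * m))
    (a : ℝ) : turnLength R X (a + 2 * π) - turnLength R X a = 2 * m := by
  have hR := hX.pos
  have hle : a ≤ a + 2 * π := by linarith [pi_pos]
  rw [hX.perimeter_eq hK hconv hint a, ENNReal.ofReal_eq_ofReal_iff
    (intervalIntegral.integral_nonneg hle fun t _ => hX.curvRadius_nonneg t) (by positivity),
    hX.integral_curvRadius, mul_comm 2 R, mul_assoc] at hper
  exact mul_left_cancel₀ hR.ne' hper

theorem mainTheorem4 (lam : ℝ) (hlam : 0 < lam) (K L : Set (EuclideanSpace ℝ (Fin 2)))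
    (hK : IsLambdaConvexBody lam K) (hL : IsLambdaConvexLens lam L)
    (hKL : perimeter K = perimeter L) :
    volume L ≤ volume K ∧ (volume K = volume L → IsLambdaConvexLens lam K) := by
  obtain ⟨m, ⟨hm0, hmπ⟩, hperL, hvolL⟩ := hL.exists_perimeter_volume hlam
  obtain ⟨X, hX⟩ := hK.exists_isRollingCurve hlam
  have hclosed := hK.isCompact.isClosed
  have hm := hX.turnLength_sub_eq_of_perimeter_eq hclosed hK.convex hK.interior_nonempty hm0.le
    (hKL.trans hperL)
  have hvolK := hX.sub_sin_le_volume hK.convex hK.interior_nonempty hm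
  refine ⟨hvolL.trans hvolK, fun hvol => ?_⟩
  obtain ⟨c₁, c₂, hne, hK_eq⟩ := hX.exists_lens_of_volume_eq hclosed hK.convex
    hK.interior_nonempty hm0 hmπ hm (le_antisymm (hvol.trans_le hvolL) hvolK)
  exact ⟨c₁, c₂, hne, hK_eq, hK.interior_nonempty⟩
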